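/- **Setting.** Let $n,m\ge 1$ and $p$ be integers, let $f_{i,j}:\mathbb R^p\to\mathbb R$ ($1\le i\le n$, $1\le j\le m$), and put $f_i=\frac1m\sum_{j=1}^m f_{i,j}$, $F=\frac1n\sum_{i=1}^n f_i$, $F^*=\inf_{\mathbf x} F(\mathbf x)$. Norms are Euclidean. Assume that for some $L>0$ every $f_{i,j}$ is differentiable with $\|\nabla f_{i,j}(\mathbf x)-\nabla f_{i,j}(\mathbf y)\|\le L\|\mathbf x-\mathbf y\|$ for all $\mathbf x,\mathbf y$, and that $F^*>-\infty$. Let $W=(w_{ir})\in\mathbb R^{n\times n}$ be primitive and doubly stochastic, and let $\lambda\in[0,1)$ be its second largest singular value (assumed less than $1$; $\lambda=0$ if $n=1$). **Algorithm (GT-SAGA).** Given a step-size $\alpha>0$ and a deterministic point $\overline{\mathbf x}^0\in\mathbb R^p$, set $\mathbf x_i^0=\mathbf z_{i,j}^0=\overline{\mathbf x}^0$, $\mathbf y_i^0=\mathbf g_i^{-1}=0$ for all $i,j$, and for $k=0,1,2,\dots$ and every $i$ $$\mathbf g_i^k=\nabla f_{i,\tau_i^k}(\mathbf x_i^k)-\nabla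 f_{i,\tau_i^k}(\mathbf z_{i,\tau_i^k}^k)+\frac1m\sum_{j=1}^m\nabla f_{i,j}(\mathbf z_{i,j}^k),$$ $$\mathbf y_i^{k+1}=\sum_{r=1}^n w_{ir}(\mathbf y_r^k+\mathbf g_r^k-\mathbf g_r^{k-1}),\qquad \mathbf x_i^{k+1}=\sum_{r=1}^n w_{ir}(\mathbf x_r^k-\alpha\mathbf y_r^{k+1}),$$ $\mathbf z_{i,j}^{k+1}=\mathbf x_i^k$ if $j=s_i^k$ and $\mathbf z_{i,j}^{k+1}=\mathbf z_{i,j}^k$ otherwise. Here all $\tau_i^k$ and $s_i^k$ are uniformly distributed on $\{1,\dots,m\}$, and the family $\{\tau_i^k,s_i^k: 1\le i\le n,\ k\ge0\}$ is independent. **Theorem 1.** Let $$\overline\alpha_1:=\min\left\{\frac{(1-\lambda^2)^2}{48\lambda},\ \frac{2n^{1/3}}{13m^{2/3}},\ \frac12,\ \frac{(1-\lambda^2)^{3/4}}{18\lambda^{1/2}m^{1/2}}\right\}\frac1L ,$$ where the first and the fourth term are read as $+\infty$ if $\lambda=0$. If $0<\alpha\le\overline\alpha_1$, then for all $i,r\in\{1,\dots,n\}$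 $$\mathbb P\Big(\lim_{k\to\infty}\|\mathbf x_i^k-\mathbf x_r^k\|=0\Big)=1,\qquad \lim_{k\to\infty}\mathbb E\big[\|\mathbf x_i^k-\mathbf x_r^k\|^2\big]=0,$$ $$\mathbb P\Big(\lim_{k\to\infty}\|\nabla F(\mathbf x_i^k)\|=0\Big)=1,\qquad \lim_{k\to\infty}\mathbb E\big[\|\nabla F(\mathbf x_i^k)\|^2\big]=0,$$ where all these expectations are finite. Moreover, there is a universal constant $C>0$ (independent of all the data above and of $\epsilon$) such that, if $\alpha=\overline\alpha_1$, then for every $\epsilon>0$ the iteration complexity $$\inf\Big\{K\ge1:\ \frac1n\sum_{i=1}^n\frac1K\sum_{k=0}^{K-1}\mathbb E\big[\|\nabla F(\mathbf x_i^k)\|^2\big]\le\epsilon\Big\}$$ is at most $$\max\left\{1,\ \left\lceil C\left(\frac{E\,L\,(F(\overline{\mathbf x}^0)-F^*)}{\epsilon}+\frac{\lambda^2(1-\lambda^2)\,\|\nabla\mathbf f(\mathbf x^0)\|^2}{n\,\epsilon}\right)\right\rceil\right\},$$ where $E:=\max\left\{\frac{m^{2/3}}{n^{1/3}},\,1,\,\frac{\lambda}{(1-\lambda)^2},\,\frac{\lambda^{1/2}m^{1/2}}{(1-\lambda)^{3/4}}\right\}$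 and $\|\nabla\mathbf f(\mathbf x^0)\|^2:=\sum_{i=1}^n\|\nabla f_i(\overline{\mathbf x}^0)\|^2$. -/

import Mathlib

open MeasureTheory ProbabilityTheory Filter Topology
open scoped ENNReal

noncomputable section

namespace GTSAGA

/-- The space `ℝ^p` with its Euclidean norm. -/
abbrev Vec (p : ℕ) : Type := EuclideanSpace ℝ (Fin p)

variable {n m p : ℕ}

/-! ### The optimization problem -/

/-- The local batch function `f_i = (1/m) ∑_j f_{i,j}`. -/
def localFun (f : Fin n → Fin m → Vec p → ℝ) (i : Fin n) (x : Vec p) : ℝ :=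
  (1 / (m : ℝ)) * ∑ j, f i j x

/-- The global function `F = (1/n) ∑_i f_i`. -/
def globalFun (f : Fin n → Fin m → Vec p → ℝ) (x : Vec p) : ℝ :=
  (1 / (n : ℝ)) * ∑ i, localFun f i x

/-- The infimum `F^*` of the global function. -/
def globalInf (f : Fin n → Fin m → Vec p → ℝ) : ℝ :=
  ⨅ x, globalFun f x

/-- Every component function is differentiable with `L`-Lipschitz gradient, and the global
function is bounded below. -/
structure SmoothBounded (f : Fin n → Fin m → Vec p → ℝ) (L : ℝ) : Prop where
  pos : 0 < L
  differentiable : ∀ i j, Differentiable ℝ (f i j)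
  smooth : ∀ i j x y, ‖gradient (f i j) x - gradient (f i j) y‖ ≤ L * ‖x - y‖
  bddBelow : BddBelow (Set.range (globalFun f))

/-! ### The network -/

/-- The second largest singular value of a square matrix (singular values are listed in
decreasing order with multiplicity, and numbered from zero). For a `1 × 1` matrix there is no
second singular value, and this is `0`. -/
def secondSingularValue (W : Matrix (Fin n) (Fin n) ℝ) : ℝ :=
  (Matrix.toEuclideanLin W).singularValues 1

/-- The weight matrix is primitive and doubly stochastic, and its second largest singular value
is less than one. -/
structure NetworkWeights (W : Matrix (Fin n) (Fin n) ℝ) : Prop where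
  primitive : W.IsPrimitive
  row_sum : ∀ i, ∑ r, W i r = 1
  col_sum : ∀ r, ∑ i, W i r = 1
  singular_lt_one : secondSingularValue W < 1

/-! ### The algorithm -/

/-- The variables held by the nodes at the beginning of iteration `k`: the estimates `x_i^k`, the
gradient trackers `y_i^k`, the points `z_{i,j}^k` at which the tabulated component gradients were
computed, and the previous gradient estimators `g_i^{k-1}`. -/
structure State (n m p : ℕ) where
  x : Fin n → Vec p
  y : Fin n → Vec p
  z : Fin n → Fin m → Vec p
  gPrev : Fin n → Vec p

/-- The SAGA estimator `g_i^k` of the local batch gradient, for the sampled index `t = τ_i^k`. -/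
def sagaEstimator (f : Fin n → Fin m → Vec p → ℝ) (S : State n m p) (i : Fin n) (t : Fin m) :
    Vec p :=
  gradient (f i t) (S.x i) - gradient (f i t) (S.z i t)
    + (1 / (m : ℝ)) • ∑ j, gradient (f i j) (S.z i j)

/-- The updated gradient tracker `y_i^{k+1}`, for the sampled indices `τ_r^k = t r`. -/
def trackerUpdate (f : Fin n → Fin m → Vec p → ℝ) (W : Matrix (Fin n) (Fin n) ℝ)
    (S : State n m p) (t : Fin n → Fin m) (i : Fin n) : Vec p :=
  ∑ r, W i r • (S.y r + sagaEstimator f S r (t r) - S.gPrev r)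

/-- One iteration, with estimator indices `τ_i^k = t i` and table indices `s_i^k = s i`. -/
def step (f : Fin n → Fin m → Vec p → ℝ) (W : Matrix (Fin n) (Fin n) ℝ) (α : ℝ)
    (S : State n m p) (t s : Fin n → Fin m) : State n m p where
  x := fun i => ∑ r, W i r • (S.x r - α • trackerUpdate f W S t r)
  y := fun i => trackerUpdate f W S t i
  z := fun i j => if j = s i then S.x i else S.z i j
  gPrev := fun i => sagaEstimator f S i (t i)

/-- The initial state: all nodes start at `x0`, the trackers and the estimators `g_i^{-1}` are
zero. -/
def initState (n m : ℕ) (x0 : Vec p) : State n m p where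
  x := fun _ => x0
  y := fun _ => 0
  z := fun _ _ => x0
  gPrev := fun _ => 0

/-- The state after `k` iterations, for given sequences of sampled indices `τ_i^k = t k i` and
`s_i^k = s k i`. -/
def run (f : Fin n → Fin m → Vec p → ℝ) (W : Matrix (Fin n) (Fin n) ℝ) (α : ℝ) (x0 : Vec p)
    (t s : ℕ → Fin n → Fin m) : ℕ → State n m p
  | 0 => initState n m x0
  | k + 1 => step f W α (run f W α x0 t s k) (t k) (s k)

variable {Ω : Type*}

/-- The random estimate `x_i^k` of node `i` after `k` iterations. -/
def iterate (f : Fin n → Fin m → Vec p → ℝ) (W : Matrix (Fin n) (Fin n) ℝ) (α : ℝ) (x0 : Vec p)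
    (τ s : ℕ → Fin n → Ω → Fin m) (k : ℕ) (i : Fin n) (ω : Ω) : Vec p :=
  (run f W α x0 (fun k i => τ k i ω) (fun k i => s k i ω) k).x i

/-- The sampled indices `τ_i^k` and `s_i^k` are random variables, uniform on the `m` indices, and
the whole family `{τ_i^k, s_i^k : i, k}` is independent. -/
structure IndependentSampling [MeasurableSpace Ω] (P : Measure Ω)
    (τ s : ℕ → Fin n → Ω → Fin m) : Prop where
  measurable_tau : ∀ k i, Measurable (τ k i)
  measurable_s : ∀ k i, Measurable (s k i)
  uniform_tau : ∀ k i j, P (τ k i ⁻¹' {j}) = (m : ℝ≥0∞)⁻¹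
  uniform_s : ∀ k i j, P (s k i ⁻¹' {j}) = (m : ℝ≥0∞)⁻¹
  indep : iIndepFun
    (Sum.elim (fun q : ℕ × Fin n => τ q.1 q.2) (fun q : ℕ × Fin n => s q.1 q.2)) P

/-! ### Step-size and complexity -/

/-- The largest admissible step-size
`min {(1-λ²)²/(48λ), 2n^{1/3}/(13m^{2/3}), 1/2, (1-λ²)^{3/4}/(18λ^{1/2}m^{1/2})} / L`.
The first and the fourth term are `+∞` if `λ = 0`, so they are left out of the minimum then. -/
def stepBound (n m : ℕ) (lam L : ℝ) : ℝ :=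
  (if lam = 0 then min (2 * (n : ℝ) ^ (1 / 3 : ℝ) / (13 * (m : ℝ) ^ (2 / 3 : ℝ))) (1 / 2)
    else min (min ((1 - lam ^ 2) ^ 2 / (48 * lam))
        (2 * (n : ℝ) ^ (1 / 3 : ℝ) / (13 * (m : ℝ) ^ (2 / 3 : ℝ))))
      (min (1 / 2)
        ((1 - lam ^ 2) ^ (3 / 4 : ℝ) / (18 * lam ^ (1 / 2 : ℝ) * (m : ℝ) ^ (1 / 2 : ℝ))))) *
    (1 / L)

/-- `E = max {m^{2/3}/n^{1/3}, 1, λ/(1-λ)², λ^{1/2}m^{1/2}/(1-λ)^{3/4}}`. -/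
def complexityFactor (n m : ℕ) (lam : ℝ) : ℝ :=
  max (max ((m : ℝ) ^ (2 / 3 : ℝ) / (n : ℝ) ^ (1 / 3 : ℝ)) 1)
    (max (lam / (1 - lam) ^ 2)
      (lam ^ (1 / 2 : ℝ) * (m : ℝ) ^ (1 / 2 : ℝ) / (1 - lam) ^ (3 / 4 : ℝ)))

/-- The stationarity measure `(1/n) ∑_i (1/K) ∑_{k<K} 𝔼 ‖∇F(x_i^k)‖²` of the first `K`
iterates. -/
def stationarityGap [MeasurableSpace Ω] (P : Measure Ω)
    (f : Fin n → Fin m → Vec p → ℝ) (W : Matrix (Fin n) (Fin n) ℝ) (α : ℝ) (x0 : Vec p)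
    (τ s : ℕ → Fin n → Ω → Fin m) (K : ℕ) : ℝ :=
  (1 / (n : ℝ)) * ∑ i, (1 / (K : ℝ)) * ∑ k ∈ Finset.range K,
    ∫ ω, ‖gradient (globalFun f) (iterate f W α x0 τ s k i ω)‖ ^ 2 ∂P

/-- The iteration complexity: the least number `K ≥ 1` of iterations for which the stationarity
measure is at most `ε` (and `⊤` if there is none). -/
def iterationComplexity [MeasurableSpace Ω] (P : Measure Ω)
    (f : Fin n → Fin m → Vec p → ℝ) (W : Matrix (Fin n) (Fin n) ℝ) (α : ℝ) (x0 : Vec p)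
    (τ s : ℕ → Fin n → Ω → Fin m) (ε : ℝ) : ℕ∞ :=
  ⨅ K : {K : ℕ // 1 ≤ K ∧ stationarityGap P f W α x0 τ s K ≤ ε}, ((K : ℕ) : ℕ∞)

end GTSAGA

end

namespace GTSAGA

open scoped RealInnerProductSpace BigOperators

/-! Double stochasticity and the zero initialization keep the mean of the trackers equal to the mean
of the current gradient estimators. The network mean of the estimates therefore makes a stochastic
gradient step on F, with conditional mean `meanGrad` and variance `noiseVar / n`. Smoothness of F
gives a descent inequality (`expect_globalFun_step_le`) that dissipates N = ‖∇F‖² at the mean and G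
= ‖`meanGrad`‖², and whose only error terms are the dispersion X of the estimates and the estimator
variance V.

It remains to bound the sums of X and V by multiples of the sum of G that the descent can absorb.
Lipschitz gradients give V ≤ 2L²(X + T), with T the mean squared distance to the tabulated points. T
contracts at rate 1 - 1/(2m), because each table entry is refreshed with probability 1/m. X
contracts at rate (1+λ²)/2, because W shrinks mean-zero vectors by λ (`norm_sq_toEuclideanLin_le`),
and it is forced by V and by the dispersion A of `trackingInput`. A contracts at the same rate,
forced by V, G and X.

Summing each recursion over the iterations turns this coupled system into linear inequalities
between a few sums. The step-size conditions make the gain of the feedback loop less than one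
(`DescentSystem.sum_consensus_le`), and the dissipated G pays for the rest
(`DescentSystem.sum_stationarity_le`). So the sum over k of 𝔼[‖∇F‖² + L²·dispersion] is bounded
uniformly in the horizon (`sum_integral_le`). Summability gives the limits in mean and, by Tonelli,
almost surely; division by the horizon gives the complexity.

The state after k iterations is a function of finitely many samples with finitely many values, so
conditioning on the past reduces to finite uniform averages (`integral_randomState_step`). -/

/-! ### Spectral contraction of the mixing matrix. -/

/-- Diagonalize TᵀT with eigenvalues in decreasing order. The all-ones vector is fixed by T and by
its adjoint, and every eigenvalue after the top one is below 1, so that vector spans the top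
eigendirection. A mean-zero vector is orthogonal to it and only sees the remaining eigenvalues. -/
lemma norm_sq_toEuclideanLin_le {n : ℕ} {W : Matrix (Fin n) (Fin n) ℝ}
    (hrow : ∀ i, ∑ r, W i r = 1) (hcol : ∀ r, ∑ i, W i r = 1)
    (hlt : secondSingularValue W < 1) (v : EuclideanSpace ℝ (Fin n)) (hv : ∑ i, v i = 0) :
    ‖Matrix.toEuclideanLin W v‖ ^ 2 ≤ secondSingularValue W ^ 2 * ‖v‖ ^ 2 := by
  set T := Matrix.toEuclideanLin W with hT
  have hn : Module.finrank ℝ (EuclideanSpace ℝ (Fin n)) = n := by simp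
  have hS := T.isSymmetric_adjoint_comp_self
  set b := hS.eigenvectorBasis hn with hb
  set e := hS.eigenvalues hn with he
  have hrepr : ∀ w i, b.repr ((LinearMap.adjoint T ∘ₗ T) w) i = e i * b.repr w i := by
    intro w i
    have := hS.eigenvectorBasis_apply_self_apply hn w i
    simpa using this
  have he1 : ∀ i : Fin n, (i : ℕ) ≠ 0 → e i ≤ secondSingularValue W ^ 2 := by
    intro i hi
    rw [he, ← T.sq_singularValues_fin hn i]
    have h1 : T.singularValues i ≤ T.singularValues 1 :=
      T.singularValues_antitone (Nat.one_le_iff_ne_zero.mpr hi)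
    exact pow_le_pow_left₀ (T.singularValues_nonneg _) h1 2
  have hσ0 : 0 ≤ secondSingularValue W := T.singularValues_nonneg 1
  have hσ1 : secondSingularValue W ^ 2 < 1 := by nlinarith
  set u : EuclideanSpace ℝ (Fin n) := WithLp.toLp 2 (fun _ => (1 : ℝ)) with hu
  have hTu : T u = u := by
    ext i
    simp [hT, hu, Matrix.toLpLin_apply, Matrix.mulVec, dotProduct, hrow]
  have hTu' : LinearMap.adjoint T u = u := by
    rw [hT, ← Matrix.toEuclideanLin_conjTranspose_eq_adjoint]
    ext i
    simp [hu, Matrix.toLpLin_apply, Matrix.mulVec, dotProduct, hcol]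
  -- The vector `u` has eigenvalue 1, while `e i < 1` away from index 0.
  have hu0 : ∀ i : Fin n, (i : ℕ) ≠ 0 → b.repr u i = 0 := by
    intro i hi
    have h1 := hrepr u i
    rw [LinearMap.comp_apply, hTu, hTu'] at h1
    have h2 := he1 i hi
    have h3 : (1 - e i) * b.repr u i = 0 := by linarith
    rcases mul_eq_zero.mp h3 with h | h
    · linarith
    · exact h
  have hv0 : ∀ i : Fin n, (i : ℕ) = 0 → b.repr v i = 0 := by
    intro i hi
    have h1 : ⟪u, v⟫ = 0 := by
      simpa [hu, PiLp.inner_apply] using hv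
    rw [← b.repr.inner_map_map, PiLp.inner_apply, Finset.sum_eq_single i] at h1
    · simp only [RCLike.inner_apply, conj_trivial, mul_eq_zero] at h1
      rcases h1 with h1 | h1
      · exact h1
      · exfalso
        have : b.repr u = 0 := by
          ext j
          by_cases hj : j = i
          · rw [hj]; simpa using h1
          · have : (j : ℕ) ≠ 0 := fun h => hj (Fin.ext (h.trans hi.symm))
            simpa using hu0 j this
        have hu1 : u = 0 := by simpa using this
        have : u i = 0 := by rw [hu1]; rfl
        simp [hu] at this
    · intro j _ hj
      have : (j : ℕ) ≠ 0 := fun h => hj (Fin.ext (h.trans hi.symm))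
      simp [hu0 j this]
    · simp
  have hmain : ‖T v‖ ^ 2 = ∑ i, e i * b.repr v i ^ 2 := by
    rw [← real_inner_self_eq_norm_sq, ← LinearMap.adjoint_inner_left, ← b.repr.inner_map_map,
      PiLp.inner_apply]
    refine Finset.sum_congr rfl fun i _ => ?_
    have := hrepr v i
    rw [LinearMap.comp_apply] at this
    simp only [RCLike.inner_apply, conj_trivial, this]
    ring
  have hnorm : ‖v‖ ^ 2 = ∑ i, b.repr v i ^ 2 := by
    rw [← b.repr.norm_map, EuclideanSpace.real_norm_sq_eq]
  rw [hmain, hnorm, Finset.mul_sum]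
  refine Finset.sum_le_sum fun i _ => ?_
  by_cases hi : (i : ℕ) = 0
  · simp [hv0 i hi]
  · exact mul_le_mul_of_nonneg_right (he1 i hi) (sq_nonneg _)

/-- The scalar bound applies to each of the p coordinates separately. -/
lemma sum_norm_sq_mix_le {n p : ℕ} {W : Matrix (Fin n) (Fin n) ℝ} (hW : NetworkWeights W)
    (u : Fin n → Vec p) (hu : ∑ i, u i = 0) :
    ∑ i, ‖∑ r, W i r • u r‖ ^ 2 ≤ secondSingularValue W ^ 2 * ∑ i, ‖u i‖ ^ 2 := by
  simp only [EuclideanSpace.real_norm_sq_eq]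
  rw [Finset.sum_comm, Finset.sum_comm (f := fun i j => (u i) j ^ 2), Finset.mul_sum]
  refine Finset.sum_le_sum fun j _ => ?_
  have h := norm_sq_toEuclideanLin_le hW.row_sum hW.col_sum hW.singular_lt_one
    (WithLp.toLp 2 fun i => u i j) (by
      have := congrArg (fun w : Vec p => w j) hu
      simpa using this)
  rw [EuclideanSpace.real_norm_sq_eq, EuclideanSpace.real_norm_sq_eq] at h
  simpa [Matrix.toLpLin_apply, Matrix.mulVec, dotProduct] using h

/-! ### Finite averages over independent uniform indices. -/

section Sampling

variable {n m p : ℕ}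

/-- Exchanging the i-th coordinate with a fresh index is an involution of the pairs, so it preserves
the uniform average. This is independence of the coordinates in finite form. -/
lemma expect_resample (Φ : (Fin n → Fin m) → ℝ) (i : Fin n) :
    𝔼 t, Φ t = 𝔼 t, 𝔼 j, Φ (Function.update t i j) := by
  have hinv : Function.Involutive (fun q : (Fin n → Fin m) × Fin m =>
      (Function.update q.1 i q.2, q.1 i)) := by
    rintro ⟨t, j⟩
    simp
  have h1 : 𝔼 q : (Fin n → Fin m) × Fin m, Φ q.1
      = 𝔼 q : (Fin n → Fin m) × Fin m, Φ (Function.update q.1 i q.2) :=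
    (Fintype.expect_equiv hinv.toPerm _ _ fun q => rfl).symm
  rw [← Finset.univ_product_univ, Finset.expect_product, Finset.expect_product] at h1
  rw [← h1]
  rcases isEmpty_or_nonempty (Fin m) with h | h
  · have : IsEmpty (Fin n → Fin m) := ⟨fun t => h.false (t i)⟩
    simp
  · simp

lemma expect_apply (φ : Fin m → ℝ) (i : Fin n) :
    𝔼 t : Fin n → Fin m, φ (t i) = 𝔼 j, φ j := by
  rcases isEmpty_or_nonempty (Fin m) with h | h
  · have : IsEmpty (Fin n → Fin m) := ⟨fun t => h.false (t i)⟩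
    simp
  · rw [expect_resample (fun t => φ (t i)) i]
    simp

lemma expect_inner_eq_zero (u : Vec p) {η : Fin m → Vec p} (hη : ∑ j, η j = 0) :
    𝔼 j, ⟪u, η j⟫ = 0 := by
  rw [Finset.expect_eq_sum_div_card, ← inner_sum, hη]
  simp

lemma expect_norm_add_sq [NeZero m] (u : Vec p) (c : ℝ) {η : Fin m → Vec p}
    (hη : ∑ j, η j = 0) :
    𝔼 j, ‖u + c • η j‖ ^ 2 = ‖u‖ ^ 2 + c ^ 2 * 𝔼 j, ‖η j‖ ^ 2 := by
  have h : ∀ j, ‖u + c • η j‖ ^ 2 = ‖u‖ ^ 2 + 2 * c * ⟪u, η j⟫ + c ^ 2 * ‖η j‖ ^ 2 := by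
    intro j
    rw [norm_add_sq_real, real_inner_smul_right, norm_smul, mul_pow, Real.norm_eq_abs, sq_abs]
    ring
  simp only [h, Finset.expect_add_distrib, ← Finset.mul_expect, expect_inner_eq_zero u hη]
  simp

/-- Independent centered terms have no cross terms; the induction averages out one coordinate at a
time. -/
lemma expect_norm_add_sum_sq [NeZero m] (u : Vec p) (c : Fin n → ℝ) {ξ : Fin n → Fin m → Vec p}
    (hξ : ∀ i, ∑ j, ξ i j = 0) :
    𝔼 t : Fin n → Fin m, ‖u + ∑ r, c r • ξ r (t r)‖ ^ 2
      = ‖u‖ ^ 2 + ∑ r, c r ^ 2 * 𝔼 j, ‖ξ r j‖ ^ 2 := by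
  induction (Finset.univ : Finset (Fin n)) using Finset.induction_on with
  | empty => simp
  | insert i R hi ih =>
    rw [Finset.sum_insert hi]
    have h1 : ∀ t : Fin n → Fin m, 𝔼 j, ‖u + ∑ r ∈ insert i R,
        c r • ξ r (Function.update t i j r)‖ ^ 2
        = ‖u + ∑ r ∈ R, c r • ξ r (t r)‖ ^ 2 + c i ^ 2 * 𝔼 j, ‖ξ i j‖ ^ 2 := by
      intro t
      rw [← expect_norm_add_sq _ _ (hξ i)]
      refine Finset.expect_congr rfl fun j _ => ?_
      have h2 : ∑ r ∈ R, c r • ξ r (Function.update t i j r) = ∑ r ∈ R, c r • ξ r (t r) := by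
        refine Finset.sum_congr rfl fun r hr => ?_
        rw [Function.update_of_ne (by rintro rfl; exact hi hr)]
      rw [Finset.sum_insert hi, h2, Function.update_self]
      congr 2
      abel
    rw [expect_resample _ i]
    simp only [h1, Finset.expect_add_distrib, ih]
    simp
    ring

lemma expect_inner_sum_eq_zero (u : Vec p) (c : Fin n → ℝ) {ξ : Fin n → Fin m → Vec p}
    (hξ : ∀ i, ∑ j, ξ i j = 0) :
    𝔼 t : Fin n → Fin m, ⟪u, ∑ r, c r • ξ r (t r)⟫ = 0 := by
  simp only [inner_sum, real_inner_smul_right]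
  rw [Finset.expect_sum_comm]
  refine Finset.sum_eq_zero fun r _ => ?_
  rw [← Finset.mul_expect, expect_apply (fun j => ⟪u, ξ r j⟫) r, expect_inner_eq_zero u (hξ r),
    mul_zero]

end Sampling

/-! ### Gradients of the averaged functions and the quadratic upper bound. -/

section Smoothness

variable {n m p : ℕ}

lemma hasGradientAt_const_mul_sum {ι : Type*} [Fintype ι] {φ : ι → Vec p → ℝ} {x : Vec p}
    (c : ℝ) (h : ∀ i, DifferentiableAt ℝ (φ i) x) :
    HasGradientAt (fun y => c * ∑ i, φ i y) (c • ∑ i, gradient (φ i) x) x := by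
  rw [hasGradientAt_iff_hasFDerivAt]
  have h1 : HasFDerivAt (fun y => ∑ i, φ i y) (∑ i, fderiv ℝ (φ i) x) x :=
    HasFDerivAt.fun_sum fun i _ => (h i).hasFDerivAt
  have h2 := h1.const_mul c
  have h3 : InnerProductSpace.toDual ℝ (Vec p) (c • ∑ i, gradient (φ i) x)
      = c • ∑ i, fderiv ℝ (φ i) x := by
    rw [map_smul, map_sum]
    simp only [toDual_gradient]
  rw [h3]
  exact h2

lemma localFun_hasGradientAt {f : Fin n → Fin m → Vec p → ℝ} {L : ℝ} (hf : SmoothBounded f L)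
    (i : Fin n) (x : Vec p) :
    HasGradientAt (localFun f i) ((1 / (m : ℝ)) • ∑ j, gradient (f i j) x) x :=
  hasGradientAt_const_mul_sum _ fun j => hf.differentiable i j x

lemma gradient_localFun {f : Fin n → Fin m → Vec p → ℝ} {L : ℝ} (hf : SmoothBounded f L)
    (i : Fin n) (x : Vec p) :
    gradient (localFun f i) x = (1 / (m : ℝ)) • ∑ j, gradient (f i j) x :=
  (localFun_hasGradientAt hf i x).gradient

lemma globalFun_hasGradientAt {f : Fin n → Fin m → Vec p → ℝ} {L : ℝ} (hf : SmoothBounded f L)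
    (x : Vec p) :
    HasGradientAt (globalFun f) ((1 / (n : ℝ)) • ∑ i, gradient (localFun f i) x) x :=
  hasGradientAt_const_mul_sum _ fun i => (localFun_hasGradientAt hf i x).differentiableAt

lemma gradient_globalFun {f : Fin n → Fin m → Vec p → ℝ} {L : ℝ} (hf : SmoothBounded f L)
    (x : Vec p) :
    gradient (globalFun f) x = (1 / (n : ℝ)) • ∑ i, gradient (localFun f i) x :=
  (globalFun_hasGradientAt hf x).gradient

lemma norm_average_le {N : ℕ} (hN : 0 < N) (w : Fin N → Vec p) {B : ℝ} (h : ∀ i, ‖w i‖ ≤ B) :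
    ‖(1 / (N : ℝ)) • ∑ i, w i‖ ≤ B := by
  have hN' : (0 : ℝ) < N := by exact_mod_cast hN
  rw [norm_smul, Real.norm_of_nonneg (by positivity)]
  have h1 : ‖∑ i, w i‖ ≤ N * B := by
    refine (norm_sum_le _ _).trans ((Finset.sum_le_sum fun i _ => h i).trans ?_)
    simp
  calc 1 / (N : ℝ) * ‖∑ i, w i‖ ≤ 1 / (N : ℝ) * (N * B) := by gcongr
    _ = B := by field_simp

lemma norm_gradient_localFun_sub_le (hm : 0 < m) {f : Fin n → Fin m → Vec p → ℝ} {L : ℝ}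
    (hf : SmoothBounded f L) (i : Fin n) (x y : Vec p) :
    ‖gradient (localFun f i) x - gradient (localFun f i) y‖ ≤ L * ‖x - y‖ := by
  rw [gradient_localFun hf, gradient_localFun hf, ← smul_sub, ← Finset.sum_sub_distrib]
  exact norm_average_le hm _ fun j => hf.smooth i j x y

lemma norm_gradient_globalFun_sub_le (hn : 0 < n) (hm : 0 < m)
    {f : Fin n → Fin m → Vec p → ℝ} {L : ℝ} (hf : SmoothBounded f L) (x y : Vec p) :
    ‖gradient (globalFun f) x - gradient (globalFun f) y‖ ≤ L * ‖x - y‖ := by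
  rw [gradient_globalFun hf, gradient_globalFun hf, ← smul_sub, ← Finset.sum_sub_distrib]
  exact norm_average_le hn _ fun i => norm_gradient_localFun_sub_le hm hf i x y

/-- Along the segment, φ minus its quadratic model has nonpositive derivative, by Cauchy-Schwarz and
the Lipschitz bound. -/
lemma le_quadratic_upper_bound {φ : Vec p → ℝ} {L : ℝ} (hd : Differentiable ℝ φ)
    (hL : ∀ x y, ‖gradient φ x - gradient φ y‖ ≤ L * ‖x - y‖) (x d : Vec p) :
    φ (x + d) ≤ φ x + ⟪gradient φ x, d⟫ + L / 2 * ‖d‖ ^ 2 := by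
  set ψ : ℝ → ℝ := fun s => φ (x + s • d) - s * ⟪gradient φ x, d⟫ - L / 2 * ‖d‖ ^ 2 * s ^ 2 with hψ
  have hder : ∀ s, HasDerivAt ψ
      (⟪gradient φ (x + s • d), d⟫ - ⟪gradient φ x, d⟫ - L * ‖d‖ ^ 2 * s) s := by
    intro s
    have h1 : HasDerivAt (fun s : ℝ => x + s • d) d s := by
      simpa using ((hasDerivAt_id s).smul_const d).const_add x
    have h2 : HasDerivAt (fun s : ℝ => φ (x + s • d)) ⟪gradient φ (x + s • d), d⟫ s := by
      have h3 := (hd (x + s • d)).hasFDerivAt.comp_hasDerivAt s h1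
      rw [inner_gradient_left]
      exact h3
    have h4 := (h2.sub ((hasDerivAt_id s).mul_const ⟪gradient φ x, d⟫)).sub
      (((hasDerivAt_id s).pow 2).const_mul (L / 2 * ‖d‖ ^ 2))
    refine h4.congr_deriv ?_
    simp
    ring
  have hanti : AntitoneOn ψ (Set.Icc 0 1) := by
    refine antitoneOn_of_deriv_nonpos (convex_Icc 0 1)
      (fun s _ => (hder s).continuousAt.continuousWithinAt)
      (fun s _ => (hder s).differentiableAt.differentiableWithinAt) fun s hs => ?_
    rw [interior_Icc] at hs
    rw [(hder s).deriv, ← inner_sub_left]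
    have h1 := real_inner_le_norm (gradient φ (x + s • d) - gradient φ x) d
    have h2 := hL (x + s • d) x
    rw [add_sub_cancel_left, norm_smul, Real.norm_of_nonneg hs.1.le] at h2
    nlinarith [mul_le_mul_of_nonneg_right h2 (norm_nonneg d)]
  have h := hanti (Set.left_mem_Icc.mpr zero_le_one) (Set.right_mem_Icc.mpr zero_le_one)
    zero_le_one
  simp only [hψ] at h
  rw [inner_gradient_left] at h ⊢
  simp at h
  linarith

end Smoothness

/-! ### Mean and dispersion of network vectors. -/

section Dispersion

variable {n p : ℕ}

/-- The average of the blocks of a network vector. -/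
noncomputable def mean (u : Fin n → Vec p) : Vec p := (1 / (n : ℝ)) • ∑ i, u i

/-- The average squared deviation of the blocks of a network vector from their mean. -/
noncomputable def dispersion (u : Fin n → Vec p) : ℝ := (1 / (n : ℝ)) * ∑ i, ‖u i - mean u‖ ^ 2

lemma mean_add (u v : Fin n → Vec p) : mean (fun i => u i + v i) = mean u + mean v := by
  simp [mean, Finset.sum_add_distrib]

lemma mean_sub (u v : Fin n → Vec p) : mean (fun i => u i - v i) = mean u - mean v := by
  simp [mean, Finset.sum_sub_distrib, smul_sub]

lemma mean_smul (c : ℝ) (u : Fin n → Vec p) : mean (fun i => c • u i) = c • mean u := by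
  simp only [mean, ← Finset.smul_sum]
  rw [smul_comm]

lemma mean_const (hn : 0 < n) (c : Vec p) : mean (fun _ : Fin n => c) = c := by
  have : (n : ℝ) ≠ 0 := by exact_mod_cast hn.ne'
  simp [mean, ← Nat.cast_smul_eq_nsmul ℝ, smul_smul, this]

lemma sum_sub_mean (hn : 0 < n) (u : Fin n → Vec p) : ∑ i, (u i - mean u) = 0 := by
  have : (n : ℝ) ≠ 0 := by exact_mod_cast hn.ne'
  simp [mean, Finset.sum_sub_distrib, ← Nat.cast_smul_eq_nsmul ℝ, smul_smul, this]

lemma mean_mix {W : Matrix (Fin n) (Fin n) ℝ} (hW : NetworkWeights W) (u : Fin n → Vec p) :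
    mean (fun i => ∑ r, W i r • u r) = mean u := by
  unfold mean
  rw [Finset.sum_comm]
  simp [← Finset.sum_smul, hW.col_sum]

lemma dispersion_nonneg (u : Fin n → Vec p) : 0 ≤ dispersion u := by
  unfold dispersion; positivity

/-- Bias-variance decomposition: the cross term vanishes because deviations from the mean sum to
zero. -/
lemma average_norm_sub_sq (hn : 0 < n) (u : Fin n → Vec p) (c : Vec p) :
    (1 / (n : ℝ)) * ∑ i, ‖u i - c‖ ^ 2 = dispersion u + ‖mean u - c‖ ^ 2 := by
  have hn' : (n : ℝ) ≠ 0 := by exact_mod_cast hn.ne'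
  have h : ∀ i, ‖u i - c‖ ^ 2
      = ‖u i - mean u‖ ^ 2 + 2 * ⟪u i - mean u, mean u - c⟫ + ‖mean u - c‖ ^ 2 := by
    intro i
    rw [← norm_add_sq_real]
    congr 2
    abel
  simp only [h, Finset.sum_add_distrib, ← Finset.mul_sum, ← sum_inner, sum_sub_mean hn]
  simp only [inner_zero_left, Finset.sum_const, Finset.card_univ, Fintype.card_fin, nsmul_eq_mul,
    dispersion]
  field_simp
  ring

lemma average_norm_sq (hn : 0 < n) (u : Fin n → Vec p) :
    (1 / (n : ℝ)) * ∑ i, ‖u i‖ ^ 2 = dispersion u + ‖mean u‖ ^ 2 := by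
  simpa using average_norm_sub_sq hn u 0

lemma norm_mean_sq_le (hn : 0 < n) (u : Fin n → Vec p) :
    ‖mean u‖ ^ 2 ≤ (1 / (n : ℝ)) * ∑ i, ‖u i‖ ^ 2 := by
  rw [average_norm_sq hn]
  linarith [dispersion_nonneg u]

lemma dispersion_le (hn : 0 < n) (u : Fin n → Vec p) (c : Vec p) :
    dispersion u ≤ (1 / (n : ℝ)) * ∑ i, ‖u i - c‖ ^ 2 := by
  rw [average_norm_sub_sq hn]
  linarith [sq_nonneg ‖mean u - c‖]

lemma dispersion_mix_le {W : Matrix (Fin n) (Fin n) ℝ} (hn : 0 < n) (hW : NetworkWeights W)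
    (u : Fin n → Vec p) :
    dispersion (fun i => ∑ r, W i r • u r) ≤ secondSingularValue W ^ 2 * dispersion u := by
  have h := sum_norm_sq_mix_le hW (fun i => u i - mean u) (sum_sub_mean hn u)
  have h1 : ∀ i, ∑ r, W i r • (u r - mean u)
      = ∑ r, W i r • u r - mean (fun i => ∑ r, W i r • u r) := by
    intro i
    rw [mean_mix hW]
    simp [smul_sub, Finset.sum_sub_distrib, ← Finset.sum_smul, hW.row_sum]
  simp only [h1] at h
  unfold dispersion
  calc _ ≤ 1 / (n : ℝ) * (secondSingularValue W ^ 2 * ∑ i, ‖u i - mean u‖ ^ 2) := by gcongr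
    _ = _ := by ring

/-- Lifts any scalar Young-type inequality to dispersions, so that the weights can be chosen at each
use. -/
lemma dispersion_sub_le (u v : Fin n → Vec p) {θ a b : ℝ}
    (h : ∀ x y : ℝ, 0 ≤ x → 0 ≤ y → θ * (x + y) ^ 2 ≤ a * x ^ 2 + b * y ^ 2) (hθ : 0 ≤ θ) :
    θ * dispersion (fun i => u i - v i) ≤ a * dispersion u + b * dispersion v := by
  have h1 : ∀ i, θ * ‖u i - v i - mean (fun i => u i - v i)‖ ^ 2
      ≤ a * ‖u i - mean u‖ ^ 2 + b * ‖v i - mean v‖ ^ 2 := by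
    intro i
    refine le_trans ?_ (h _ _ (norm_nonneg _) (norm_nonneg _))
    have h2 : u i - v i - mean (fun i => u i - v i) = (u i - mean u) - (v i - mean v) := by
      rw [mean_sub]; abel
    rw [h2]
    gcongr
    exact norm_sub_le _ _
  have h3 := Finset.sum_le_sum fun i (_ : i ∈ Finset.univ) => h1 i
  rw [← Finset.mul_sum, Finset.sum_add_distrib, ← Finset.mul_sum, ← Finset.mul_sum] at h3
  have h4 := mul_le_mul_of_nonneg_left h3 (by positivity : 0 ≤ 1 / (n : ℝ))
  unfold dispersion
  linarith

lemma dispersion_smul (c : ℝ) (u : Fin n → Vec p) :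
    dispersion (fun i => c • u i) = c ^ 2 * dispersion u := by
  simp only [dispersion, mean_smul, ← smul_sub, norm_smul, mul_pow, Real.norm_eq_abs, sq_abs,
    ← Finset.mul_sum]
  ring

end Dispersion

/-! ### Conditional one-step bounds for the objective and the table. -/

section OneStep

variable {n m p : ℕ}

/-- The deviation of the SAGA estimator from the local batch gradient. -/
noncomputable def noise (f : Fin n → Fin m → Vec p → ℝ) (S : State n m p) (i : Fin n) (j : Fin m) :
    Vec p :=
  sagaEstimator f S i j - gradient (localFun f i) (S.x i)

/-- The average variance of the SAGA estimators. -/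
noncomputable def noiseVar (f : Fin n → Fin m → Vec p → ℝ) (S : State n m p) : ℝ :=
  (1 / (n : ℝ)) * ∑ i, 𝔼 j, ‖noise f S i j‖ ^ 2

/-- The mean squared distance from the network mean to the tabulated points. -/
noncomputable def tableGap (S : State n m p) : ℝ :=
  (1 / (n : ℝ)) * ∑ i, 𝔼 j, ‖mean S.x - S.z i j‖ ^ 2

/-- The conditional expectation of the quantity mixed in the tracker update. -/
noncomputable def trackingInput (f : Fin n → Fin m → Vec p → ℝ) (S : State n m p) (i : Fin n) :
    Vec p :=
  S.y i - S.gPrev i + gradient (localFun f i) (S.x i)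

/-- The average over the network of the local gradients at the local estimates. -/
noncomputable def meanGrad (f : Fin n → Fin m → Vec p → ℝ) (S : State n m p) : Vec p :=
  mean fun i => gradient (localFun f i) (S.x i)

/-- The trackers and the previous gradient estimators have the same mean. -/
def Balanced (S : State n m p) : Prop := mean S.y = mean S.gPrev

lemma noiseVar_nonneg (f : Fin n → Fin m → Vec p → ℝ) (S : State n m p) : 0 ≤ noiseVar f S :=
  mul_nonneg (by positivity)
    (Finset.sum_nonneg fun _ _ => Finset.expect_nonneg fun _ _ => sq_nonneg _)

lemma tableGap_nonneg (S : State n m p) : 0 ≤ tableGap S :=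
  mul_nonneg (by positivity)
    (Finset.sum_nonneg fun _ _ => Finset.expect_nonneg fun _ _ => sq_nonneg _)

lemma expect_fin_eq (φ : Fin m → ℝ) : 𝔼 j, φ j = (1 / (m : ℝ)) * ∑ j, φ j := by
  rw [Fintype.expect_eq_sum_div_card, Fintype.card_fin]
  ring

/-- The noise is a centered gradient difference. Hence the estimator is unbiased, and its variance
is at most the second moment of that difference. -/
lemma noise_eq {f : Fin n → Fin m → Vec p → ℝ} {L : ℝ} (hf : SmoothBounded f L)
    (S : State n m p) (i : Fin n) (j : Fin m) :
    noise f S i j = (gradient (f i j) (S.x i) - gradient (f i j) (S.z i j))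
      - mean (fun j => gradient (f i j) (S.x i) - gradient (f i j) (S.z i j)) := by
  rw [noise, sagaEstimator, mean_sub, gradient_localFun hf]
  simp only [mean]
  abel

lemma sum_noise (hm : 0 < m) {f : Fin n → Fin m → Vec p → ℝ} {L : ℝ} (hf : SmoothBounded f L)
    (S : State n m p) (i : Fin n) : ∑ j, noise f S i j = 0 := by
  simp only [noise_eq hf]
  exact sum_sub_mean hm _

lemma norm_sq_le_of_norm_le {a b : Vec p} {L : ℝ} (h : ‖a‖ ≤ L * ‖b‖) :
    ‖a‖ ^ 2 ≤ L ^ 2 * ‖b‖ ^ 2 := by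
  rw [← mul_pow]
  exact pow_le_pow_left₀ (norm_nonneg _) h 2

lemma expect_noise_sq_le (hm : 0 < m) {f : Fin n → Fin m → Vec p → ℝ} {L : ℝ}
    (hf : SmoothBounded f L) (S : State n m p) (i : Fin n) :
    𝔼 j, ‖noise f S i j‖ ^ 2
      ≤ 2 * L ^ 2 * (‖S.x i - mean S.x‖ ^ 2 + 𝔼 j, ‖mean S.x - S.z i j‖ ^ 2) := by
  have hm' : (m : ℝ) ≠ 0 := by exact_mod_cast hm.ne'
  have : NeZero m := ⟨hm.ne'⟩
  have h1 : 𝔼 j, ‖noise f S i j‖ ^ 2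
      ≤ 𝔼 j, ‖gradient (f i j) (S.x i) - gradient (f i j) (S.z i j)‖ ^ 2 := by
    rw [expect_fin_eq, expect_fin_eq]
    simp only [noise_eq hf]
    have := dispersion_le hm
      (fun j => gradient (f i j) (S.x i) - gradient (f i j) (S.z i j)) 0
    simpa [dispersion] using this
  refine h1.trans ?_
  have h2 : ∀ j, ‖gradient (f i j) (S.x i) - gradient (f i j) (S.z i j)‖ ^ 2
      ≤ 2 * L ^ 2 * (‖S.x i - mean S.x‖ ^ 2 + ‖mean S.x - S.z i j‖ ^ 2) := by
    intro j
    refine (norm_sq_le_of_norm_le (hf.smooth i j _ _)).trans ?_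
    have h3 : ‖S.x i - S.z i j‖ ≤ ‖S.x i - mean S.x‖ + ‖mean S.x - S.z i j‖ :=
      norm_sub_le_norm_sub_add_norm_sub _ _ _
    have h4 : ‖S.x i - S.z i j‖ ^ 2 ≤ 2 * (‖S.x i - mean S.x‖ ^ 2 + ‖mean S.x - S.z i j‖ ^ 2) := by
      nlinarith [norm_nonneg (S.x i - S.z i j),
        sq_nonneg (‖S.x i - mean S.x‖ - ‖mean S.x - S.z i j‖)]
    nlinarith [mul_le_mul_of_nonneg_left h4 (sq_nonneg L)]
  refine (Finset.expect_le_expect fun j _ => h2 j).trans (le_of_eq ?_)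
  rw [← Finset.mul_expect, Finset.expect_add_distrib]
  simp

lemma noiseVar_le (hm : 0 < m) {f : Fin n → Fin m → Vec p → ℝ} {L : ℝ}
    (hf : SmoothBounded f L) (S : State n m p) :
    noiseVar f S ≤ 2 * L ^ 2 * (dispersion S.x + tableGap S) := by
  have h := Finset.sum_le_sum fun i (_ : i ∈ (Finset.univ : Finset (Fin n))) =>
    expect_noise_sq_le hm hf S i
  rw [← Finset.mul_sum, Finset.sum_add_distrib] at h
  have h1 := mul_le_mul_of_nonneg_left h (by positivity : 0 ≤ 1 / (n : ℝ))
  unfold noiseVar dispersion tableGap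
  linarith

lemma sagaEstimator_eq (f : Fin n → Fin m → Vec p → ℝ) (S : State n m p) (i : Fin n) (j : Fin m) :
    sagaEstimator f S i j = gradient (localFun f i) (S.x i) + noise f S i j := by
  simp [noise]

lemma trackerUpdate_eq (f : Fin n → Fin m → Vec p → ℝ) (W : Matrix (Fin n) (Fin n) ℝ)
    (S : State n m p) (t : Fin n → Fin m) (i : Fin n) :
    trackerUpdate f W S t i = ∑ r, W i r • (trackingInput f S r + noise f S r (t r)) := by
  unfold trackerUpdate
  refine Finset.sum_congr rfl fun r _ => ?_
  rw [sagaEstimator_eq, trackingInput]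
  congr 1
  abel

lemma mean_trackingInput {f : Fin n → Fin m → Vec p → ℝ} {S : State n m p} (hS : Balanced S) :
    mean (trackingInput f S) = meanGrad f S := by
  have h : mean (trackingInput f S) = mean S.y - mean S.gPrev + meanGrad f S := by
    rw [meanGrad, ← mean_sub, ← mean_add]
    rfl
  rw [h, hS, sub_self, zero_add]

lemma mean_trackerUpdate {f : Fin n → Fin m → Vec p → ℝ} {W : Matrix (Fin n) (Fin n) ℝ}
    (hW : NetworkWeights W) {S : State n m p} (hS : Balanced S) (t : Fin n → Fin m) :
    mean (trackerUpdate f W S t) = meanGrad f S + ∑ r, (1 / (n : ℝ)) • noise f S r (t r) := by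
  have h : trackerUpdate f W S t
      = fun i => ∑ r, W i r • (trackingInput f S r + noise f S r (t r)) :=
    funext fun i => trackerUpdate_eq f W S t i
  rw [h, mean_mix hW, mean_add, ← mean_trackingInput hS]
  simp [mean, Finset.smul_sum]

lemma mean_trackerUpdate_eq_mean_sagaEstimator {f : Fin n → Fin m → Vec p → ℝ}
    {W : Matrix (Fin n) (Fin n) ℝ}
    (hW : NetworkWeights W) {S : State n m p} (hS : Balanced S) (t : Fin n → Fin m) :
    mean (trackerUpdate f W S t) = mean fun i => sagaEstimator f S i (t i) := by
  unfold trackerUpdate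
  rw [mean_mix hW, mean_sub, mean_add, hS]
  abel

lemma balanced_step {f : Fin n → Fin m → Vec p → ℝ} {W : Matrix (Fin n) (Fin n) ℝ}
    (hW : NetworkWeights W) {S : State n m p} (hS : Balanced S) (α : ℝ) (t s : Fin n → Fin m) :
    Balanced (step f W α S t s) :=
  mean_trackerUpdate_eq_mean_sagaEstimator hW hS t

lemma mean_step {f : Fin n → Fin m → Vec p → ℝ} {W : Matrix (Fin n) (Fin n) ℝ}
    (hW : NetworkWeights W) (S : State n m p) (α : ℝ) (t s : Fin n → Fin m) :
    mean (step f W α S t s).x = mean S.x - α • mean (trackerUpdate f W S t) := by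
  simp only [step]
  rw [mean_mix hW, mean_sub, mean_smul]

lemma expect_norm_add_mean_noise_sq (hn : 0 < n) (hm : 0 < m) {f : Fin n → Fin m → Vec p → ℝ}
    {L : ℝ} (hf : SmoothBounded f L) (S : State n m p) (u : Vec p) (c : ℝ) :
    𝔼 t : Fin n → Fin m, ‖u + c • ∑ r, (1 / (n : ℝ)) • noise f S r (t r)‖ ^ 2
      = ‖u‖ ^ 2 + c ^ 2 * (noiseVar f S / n) := by
  have hn' : (n : ℝ) ≠ 0 := by exact_mod_cast hn.ne'
  have : NeZero m := ⟨hm.ne'⟩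
  simp only [Finset.smul_sum, smul_smul]
  rw [expect_norm_add_sum_sq u (fun _ => c * (1 / (n : ℝ))) (sum_noise hm hf S),
    ← Finset.mul_sum, noiseVar]
  field_simp

lemma norm_gradient_mean_sub_meanGrad_sq_le (hn : 0 < n) (hm : 0 < m)
    {f : Fin n → Fin m → Vec p → ℝ} {L : ℝ} (hf : SmoothBounded f L) (S : State n m p) :
    ‖gradient (globalFun f) (mean S.x) - meanGrad f S‖ ^ 2 ≤ L ^ 2 * dispersion S.x := by
  have h1 : gradient (globalFun f) (mean S.x) - meanGrad f S
      = mean fun i => gradient (localFun f i) (mean S.x) - gradient (localFun f i) (S.x i) := by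
    rw [gradient_globalFun hf, mean_sub]
    rfl
  rw [h1]
  refine (norm_mean_sq_le hn _).trans ?_
  have h2 : ∑ i, ‖gradient (localFun f i) (mean S.x) - gradient (localFun f i) (S.x i)‖ ^ 2
      ≤ L ^ 2 * ∑ i, ‖S.x i - mean S.x‖ ^ 2 := by
    rw [Finset.mul_sum]
    refine Finset.sum_le_sum fun i _ => ?_
    rw [norm_sub_rev (S.x i)]
    exact norm_sq_le_of_norm_le (norm_gradient_localFun_sub_le hm hf i _ _)
  have h3 := mul_le_mul_of_nonneg_left h2 (by positivity : 0 ≤ 1 / (n : ℝ))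
  unfold dispersion
  linarith

/-- The term -α⟪D, g⟫ is polarized into -α/2(‖D‖² + ‖g‖² - ‖D - g‖²), with ‖D - g‖² at most L² times
the dispersion. Averaging kills the linear noise term, and the n independent local errors leave only
`noiseVar / n`. -/
lemma expect_globalFun_step_le (hn : 0 < n) (hm : 0 < m) {f : Fin n → Fin m → Vec p → ℝ} {L : ℝ}
    (hf : SmoothBounded f L) {W : Matrix (Fin n) (Fin n) ℝ} (hW : NetworkWeights W)
    {S : State n m p} (hS : Balanced S) {α : ℝ} (hα : 0 < α) :
    𝔼 t, 𝔼 s, globalFun f (mean (step f W α S t s).x)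
      ≤ globalFun f (mean S.x) - α / 2 * ‖gradient (globalFun f) (mean S.x)‖ ^ 2
        - α / 2 * (1 - α * L) * ‖meanGrad f S‖ ^ 2 + α / 2 * L ^ 2 * dispersion S.x
        + L * α ^ 2 / 2 * (noiseVar f S / n) := by
  have : NeZero m := ⟨hm.ne'⟩
  set D := gradient (globalFun f) (mean S.x) with hD
  set c : ℝ := 1 / (n : ℝ)
  have hpt : ∀ t s, globalFun f (mean (step f W α S t s).x)
      ≤ globalFun f (mean S.x) - α * ⟪D, meanGrad f S⟫
        - α * ⟪D, ∑ r, c • noise f S r (t r)⟫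
        + L * α ^ 2 / 2 * ‖meanGrad f S + (1 : ℝ) • ∑ r, c • noise f S r (t r)‖ ^ 2 := by
    intro t s
    rw [mean_step hW, mean_trackerUpdate hW hS, sub_eq_add_neg]
    refine (le_quadratic_upper_bound
      (fun x => (globalFun_hasGradientAt hf x).differentiableAt)
      (norm_gradient_globalFun_sub_le hn hm hf) _ _).trans (le_of_eq ?_)
    rw [inner_neg_right, norm_neg, norm_smul, mul_pow, Real.norm_eq_abs, sq_abs,
      real_inner_smul_right, inner_add_right, one_smul]
    ring
  refine (Finset.expect_le_expect fun t _ => (Finset.expect_le_expect fun s _ => hpt t s)).trans ?_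
  simp only [Fintype.expect_const, Finset.expect_add_distrib, Finset.expect_sub_distrib,
    ← Finset.mul_expect]
  rw [expect_norm_add_mean_noise_sq hn hm hf, expect_inner_sum_eq_zero _ _ (sum_noise hm hf S)]
  have h1 := norm_gradient_mean_sub_meanGrad_sq_le hn hm hf S
  rw [norm_sub_sq_real] at h1
  nlinarith [mul_le_mul_of_nonneg_left h1 hα.le]

lemma expect_ite_apply_eq (hm : 0 < m) (i : Fin n) (j : Fin m) (a b : ℝ) :
    𝔼 s : Fin n → Fin m, (if j = s i then a else b)
      = (1 / (m : ℝ)) * a + (1 - 1 / (m : ℝ)) * b := by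
  have hm' : (m : ℝ) ≠ 0 := by exact_mod_cast hm.ne'
  have : NeZero m := ⟨hm.ne'⟩
  have h : ∀ l : Fin m, (if j = l then a else b) = b + if j = l then a - b else 0 := by
    intro l
    split_ifs <;> ring
  rw [expect_apply (fun l => if j = l then a else b) i]
  simp only [h, Finset.expect_add_distrib, Fintype.expect_const]
  rw [expect_fin_eq]
  simp
  field_simp
  ring

/-- Young's inequality spends half of the 1/m contraction. The coefficient 2m - 1/m leaves room for
the 1/m contributed by refreshed entries, so that the table recursion carries exactly 2m. -/
lemma norm_sub_smul_sq_le (w g : Vec p) (α : ℝ) (hm : 0 < m) :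
    (1 - 1 / (m : ℝ)) * ‖w - α • g‖ ^ 2
      ≤ (1 - 1 / (2 * m)) * ‖w‖ ^ 2 + (2 * m - 1 / m) * (α ^ 2 * ‖g‖ ^ 2) := by
  have hm' : (1 : ℝ) ≤ m := by exact_mod_cast hm
  have h1 : ‖w - α • g‖ ^ 2 ≤ (‖w‖ + ‖α • g‖) ^ 2 := by
    gcongr
    exact norm_sub_le _ _
  have h2 : α ^ 2 * ‖g‖ ^ 2 = ‖α • g‖ ^ 2 := by
    rw [norm_smul, mul_pow, Real.norm_eq_abs, sq_abs]
  rw [h2]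
  set x := ‖w‖
  set y := ‖α • g‖
  have h3 : 0 ≤ 1 - 1 / (m : ℝ) := by
    rw [sub_nonneg, div_le_one (by linarith)]
    exact hm'
  refine (mul_le_mul_of_nonneg_left h1 h3).trans ?_
  set k : ℝ := (m : ℝ)
  -- Completing the square in x leaves (3k - 2)/k times y², nonnegative for k ≥ 1.
  have h4 : (1 - 1 / (2 * k)) * x ^ 2 + (2 * k - 1 / k) * y ^ 2 - (1 - 1 / k) * (x + y) ^ 2
      = 1 / (2 * k) * (x - 2 * k * (1 - 1 / k) * y) ^ 2
        + (2 * k - 1 / k - (1 - 1 / k) - 2 * k * (1 - 1 / k) ^ 2) * y ^ 2 := by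
    field_simp
    ring
  have h5 : 2 * k - 1 / k - (1 - 1 / k) - 2 * k * (1 - 1 / k) ^ 2 = (3 * k - 2) / k := by
    field_simp
    ring
  have h6 : 0 ≤ (3 * k - 2) / k := div_nonneg (by linarith) (by linarith)
  rw [h5] at h4
  have h7 : 0 ≤ 1 / (2 * k) * (x - 2 * k * (1 - 1 / k) * y) ^ 2 := by positivity
  have h8 := mul_nonneg h6 (sq_nonneg y)
  linarith

/-- Each entry becomes `S.x i` with probability 1/m and otherwise stays, independently of the
estimator indices. The two averages therefore separate, and the noise adds the same amount `B` in
both cases. -/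
lemma expect_tableGap_step_le (hn : 0 < n) (hm : 0 < m) {f : Fin n → Fin m → Vec p → ℝ} {L : ℝ}
    (hf : SmoothBounded f L) {W : Matrix (Fin n) (Fin n) ℝ} (hW : NetworkWeights W)
    {S : State n m p} (hS : Balanced S) (α : ℝ) :
    𝔼 t, 𝔼 s, tableGap (step f W α S t s)
      ≤ (1 - 1 / (2 * m)) * tableGap S + dispersion S.x / m + 2 * m * α ^ 2 * ‖meanGrad f S‖ ^ 2
        + α ^ 2 * (noiseVar f S / n) := by
  have hm' : (0 : ℝ) < m := by exact_mod_cast hm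
  have hn' : (0 : ℝ) < n := by exact_mod_cast hn
  have : NeZero m := ⟨hm.ne'⟩
  set B := α ^ 2 * (noiseVar f S / n) with hB
  set g := meanGrad f S with hg
  have hE : ∀ w : Vec p, 𝔼 t : Fin n → Fin m,
      ‖mean S.x - α • (g + ∑ r, (1 / (n : ℝ)) • noise f S r (t r)) - w‖ ^ 2
        = ‖mean S.x - w - α • g‖ ^ 2 + B := by
    intro w
    have := expect_norm_add_mean_noise_sq hn hm hf S (mean S.x - w - α • g) (-α)
    rw [neg_sq] at this
    rw [hB, ← this]
    refine Finset.expect_congr rfl fun t _ => ?_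
    congr 2
    rw [smul_add, neg_smul]
    abel
  have h1 : ∀ i j, 𝔼 t, 𝔼 s, ‖mean (step f W α S t s).x - (step f W α S t s).z i j‖ ^ 2
      = (1 / (m : ℝ)) * (‖mean S.x - S.x i - α • g‖ ^ 2 + B)
        + (1 - 1 / (m : ℝ)) * (‖mean S.x - S.z i j - α • g‖ ^ 2 + B) := by
    intro i j
    rw [← hE, ← hE, Finset.mul_expect, Finset.mul_expect, ← Finset.expect_add_distrib]
    refine Finset.expect_congr rfl fun t _ => ?_
    rw [← expect_ite_apply_eq hm i j]
    refine Finset.expect_congr rfl fun s _ => ?_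
    rw [mean_step hW, mean_trackerUpdate hW hS]
    simp only [step]
    split_ifs <;> rfl
  have h2 : ∀ i, 𝔼 j, 𝔼 t, 𝔼 s, ‖mean (step f W α S t s).x - (step f W α S t s).z i j‖ ^ 2
      ≤ (1 / (m : ℝ)) * ‖mean S.x - S.x i - α • g‖ ^ 2 + B
        + ((1 - 1 / (2 * m)) * 𝔼 j, ‖mean S.x - S.z i j‖ ^ 2
          + (2 * m - 1 / m) * (α ^ 2 * ‖g‖ ^ 2)) := by
    intro i
    have h3 : ∀ j, 𝔼 t, 𝔼 s, ‖mean (step f W α S t s).x - (step f W α S t s).z i j‖ ^ 2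
      ≤ (1 / (m : ℝ)) * ‖mean S.x - S.x i - α • g‖ ^ 2 + B
        + ((1 - 1 / (2 * m)) * ‖mean S.x - S.z i j‖ ^ 2
          + (2 * m - 1 / m) * (α ^ 2 * ‖g‖ ^ 2)) := by
      intro j
      rw [h1]
      have := norm_sub_smul_sq_le (mean S.x - S.z i j) g α hm
      linarith
    refine (Finset.expect_le_expect fun j _ => h3 j).trans (le_of_eq ?_)
    simp only [Finset.expect_add_distrib, Fintype.expect_const, ← Finset.mul_expect]
  have h4 : 𝔼 t, 𝔼 s, tableGap (step f W α S t s)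
      = (1 / (n : ℝ)) * ∑ i, 𝔼 j, 𝔼 t, 𝔼 s,
        ‖mean (step f W α S t s).x - (step f W α S t s).z i j‖ ^ 2 := by
    simp only [tableGap, ← Finset.mul_expect, Finset.expect_sum_comm]
    congr 1
    refine Finset.sum_congr rfl fun i _ => ?_
    rw [Finset.expect_comm (t := (Finset.univ : Finset (Fin n → Fin m)))
      (s := (Finset.univ : Finset (Fin m)))]
    refine Finset.expect_congr rfl fun t _ => ?_
    rw [Finset.expect_comm]
  have h5 := average_norm_sub_sq hn S.x (mean S.x - α • g)
  have h6 : ∀ i, ‖S.x i - (mean S.x - α • g)‖ ^ 2 = ‖mean S.x - S.x i - α • g‖ ^ 2 := by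
    intro i
    rw [← norm_neg]
    congr 2
    abel
  simp only [h6, sub_sub_cancel, norm_smul, mul_pow, Real.norm_eq_abs, sq_abs] at h5
  have h7 := Finset.sum_le_sum fun i (_ : i ∈ (Finset.univ : Finset (Fin n))) => h2 i
  simp only [Finset.sum_add_distrib, ← Finset.mul_sum, Finset.sum_const, Finset.card_univ,
    Fintype.card_fin, nsmul_eq_mul] at h7
  have h8 := mul_le_mul_of_nonneg_left h7 (by positivity : 0 ≤ 1 / (n : ℝ))
  rw [h4]
  refine h8.trans (le_of_eq ?_)
  have h9 : ∑ i, ‖mean S.x - S.x i - α • g‖ ^ 2 = n * (dispersion S.x + α ^ 2 * ‖g‖ ^ 2) := by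
    rw [← h5]
    field_simp
  rw [h9, tableGap]
  field_simp
  ring

end OneStep

/-! ### Conditional one-step bounds for consensus and gradient tracking. -/

section OneStepConsensus

variable {n m p : ℕ}

lemma secondSingularValue_nonneg (W : Matrix (Fin n) (Fin n) ℝ) : 0 ≤ secondSingularValue W :=
  (Matrix.toEuclideanLin W).singularValues_nonneg 1

/-- Young's inequality tuned so that the contraction l² degrades to (1 + l²)/2, halfway to 1. -/
lemma sq_mul_add_sq_le {l : ℝ} (h0 : 0 ≤ l) (h1 : l < 1) (x y : ℝ) :
    l ^ 2 * (x + y) ^ 2 ≤ (1 + l ^ 2) / 2 * x ^ 2 + 2 * l ^ 2 / (1 - l ^ 2) * y ^ 2 := by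
  have hd : 0 < 1 - l ^ 2 := by nlinarith
  have h : (1 + l ^ 2) / 2 * x ^ 2 + 2 * l ^ 2 / (1 - l ^ 2) * y ^ 2 - l ^ 2 * (x + y) ^ 2
      = (1 - l ^ 2) / 2 * (x - 2 * l ^ 2 / (1 - l ^ 2) * y) ^ 2 + l ^ 2 * y ^ 2 := by
    field_simp
    ring
  have : 0 ≤ (1 - l ^ 2) / 2 * (x - 2 * l ^ 2 / (1 - l ^ 2) * y) ^ 2 + l ^ 2 * y ^ 2 := by
    positivity
  linarith

lemma expect_norm_add_noise_sq (hm : 0 < m) {f : Fin n → Fin m → Vec p → ℝ} {L : ℝ}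
    (hf : SmoothBounded f L) (S : State n m p) (u : Vec p) (i : Fin n) :
    𝔼 t : Fin n → Fin m, ‖u + noise f S i (t i)‖ ^ 2
      = ‖u‖ ^ 2 + 𝔼 j, ‖noise f S i j‖ ^ 2 := by
  have : NeZero m := ⟨hm.ne'⟩
  rw [expect_apply (fun j => ‖u + noise f S i j‖ ^ 2) i]
  simpa using expect_norm_add_sq u 1 (sum_noise hm hf S i)

lemma expect_dispersion_trackerUpdate_le (hn : 0 < n) (hm : 0 < m)
    {f : Fin n → Fin m → Vec p → ℝ} {L : ℝ} (hf : SmoothBounded f L)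
    {W : Matrix (Fin n) (Fin n) ℝ} (hW : NetworkWeights W) (S : State n m p) :
    𝔼 t : Fin n → Fin m, dispersion (trackerUpdate f W S t)
      ≤ secondSingularValue W ^ 2 * (dispersion (trackingInput f S) + noiseVar f S) := by
  set a := trackingInput f S with ha
  have h1 : ∀ t : Fin n → Fin m, dispersion (trackerUpdate f W S t)
      ≤ secondSingularValue W ^ 2 *
        ((1 / (n : ℝ)) * ∑ i, ‖a i - mean a + noise f S i (t i)‖ ^ 2) := by
    intro t
    rw [show trackerUpdate f W S t = fun i => ∑ r, W i r • (a r + noise f S r (t r)) from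
      funext fun i => trackerUpdate_eq f W S t i]
    refine (dispersion_mix_le hn hW _).trans ?_
    refine mul_le_mul_of_nonneg_left ?_ (sq_nonneg _)
    refine (dispersion_le hn _ (mean a)).trans (le_of_eq ?_)
    congr 1
    refine Finset.sum_congr rfl fun i _ => ?_
    congr 2
    abel
  refine (Finset.expect_le_expect fun t _ => h1 t).trans (le_of_eq ?_)
  rw [← Finset.mul_expect, ← Finset.mul_expect, Finset.expect_sum_comm]
  simp only [expect_norm_add_noise_sq hm hf, Finset.sum_add_distrib, mul_add]
  rfl

/-- The factor l⁴ arises because the tracker is mixed twice: once in its own update and once in the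
update of the estimates. -/
lemma expect_dispersion_step_le (hn : 0 < n) (hm : 0 < m) {f : Fin n → Fin m → Vec p → ℝ} {L : ℝ}
    (hf : SmoothBounded f L) {W : Matrix (Fin n) (Fin n) ℝ} (hW : NetworkWeights W)
    (S : State n m p) (α : ℝ) {l : ℝ} (hl : l = secondSingularValue W) :
    𝔼 t, 𝔼 s, dispersion (step f W α S t s).x
      ≤ (1 + l ^ 2) / 2 * dispersion S.x
        + 2 * l ^ 4 * α ^ 2 / (1 - l ^ 2) * (dispersion (trackingInput f S) + noiseVar f S) := by
  have : NeZero m := ⟨hm.ne'⟩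
  have hl0 : 0 ≤ l := hl ▸ secondSingularValue_nonneg W
  have hl1 : l < 1 := hl ▸ hW.singular_lt_one
  have hd : 0 < 1 - l ^ 2 := by nlinarith
  have h1 : ∀ t s, dispersion (step f W α S t s).x ≤ (1 + l ^ 2) / 2 * dispersion S.x
      + 2 * l ^ 2 / (1 - l ^ 2) * (α ^ 2 * dispersion (trackerUpdate f W S t)) := by
    intro t s
    refine (dispersion_mix_le hn hW (fun r => S.x r - α • trackerUpdate f W S t r)).trans ?_
    rw [← hl, ← dispersion_smul α]
    exact dispersion_sub_le _ _ (fun x y _ _ => sq_mul_add_sq_le hl0 hl1 x y) (sq_nonneg _)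
  refine (Finset.expect_le_expect fun t _ => (Finset.expect_le_expect fun s _ => h1 t s)).trans ?_
  simp only [Fintype.expect_const, Finset.expect_add_distrib, ← Finset.mul_expect]
  have h2 := expect_dispersion_trackerUpdate_le hn hm hf hW S
  rw [← hl] at h2
  have h3 := mul_le_mul_of_nonneg_left h2
    (by positivity : 0 ≤ 2 * l ^ 2 / (1 - l ^ 2) * α ^ 2)
  refine (add_le_add_right (le_trans (le_of_eq ?_) (h3.trans (le_of_eq ?_))) _) <;> ring

/-- The entries lie in [0, 1], so each square in a column of W - I is at most the sum of the two
entries it compares, and both columns sum to 1. -/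
lemma sum_sq_sub_one_le {W : Matrix (Fin n) (Fin n) ℝ} (hW : NetworkWeights W) (r : Fin n) :
    ∑ i, (W i r - if i = r then 1 else 0) ^ 2 ≤ 2 := by
  have h0 : ∀ i, 0 ≤ W i r := fun i => hW.primitive.nonneg i r
  have h1 : ∀ i, W i r ≤ 1 := fun i =>
    (Finset.single_le_sum (fun i _ => h0 i) (Finset.mem_univ i)).trans (hW.col_sum r).le
  have h2 : ∀ i, (W i r - if i = r then 1 else 0) ^ 2 ≤ W i r + if i = r then 1 else 0 := by
    intro i
    have := h0 i
    have := h1 i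
    split_ifs <;> nlinarith
  refine (Finset.sum_le_sum fun i _ => h2 i).trans (le_of_eq ?_)
  rw [Finset.sum_add_distrib, hW.col_sum r]
  simp
  norm_num

/-- The displacement splits into its mean, which is the stochastic gradient step, and its deviation,
bounded by the dispersions before and after. The latter is kept as it is, since it can be absorbed
after summation. -/
lemma expect_norm_step_sub_sq_le (hn : 0 < n) (hm : 0 < m) {f : Fin n → Fin m → Vec p → ℝ} {L : ℝ}
    (hf : SmoothBounded f L) {W : Matrix (Fin n) (Fin n) ℝ} (hW : NetworkWeights W)
    {S : State n m p} (hS : Balanced S) (α : ℝ) :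
    𝔼 t, 𝔼 s, (1 / (n : ℝ)) * ∑ i, ‖(step f W α S t s).x i - S.x i‖ ^ 2
      ≤ α ^ 2 * (‖meanGrad f S‖ ^ 2 + noiseVar f S / n) + 2 * dispersion S.x
        + 2 * 𝔼 t, 𝔼 s, dispersion (step f W α S t s).x := by
  have : NeZero m := ⟨hm.ne'⟩
  have h1 : ∀ t s, (1 / (n : ℝ)) * ∑ i, ‖(step f W α S t s).x i - S.x i‖ ^ 2
      ≤ α ^ 2 * ‖meanGrad f S + (1 : ℝ) • ∑ r, (1 / (n : ℝ)) • noise f S r (t r)‖ ^ 2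
        + 2 * dispersion S.x + 2 * dispersion (step f W α S t s).x := by
    intro t s
    have h2 : mean (fun i => (step f W α S t s).x i - S.x i)
        = -(α • (meanGrad f S + (1 : ℝ) • ∑ r, (1 / (n : ℝ)) • noise f S r (t r))) := by
      rw [mean_sub, mean_step hW, mean_trackerUpdate hW hS, one_smul]
      abel
    rw [average_norm_sq hn, h2, norm_neg, norm_smul, mul_pow, Real.norm_eq_abs, sq_abs]
    have h3 := dispersion_sub_le (step f W α S t s).x S.x (θ := 1) (a := 2) (b := 2)
      (fun x y _ _ => by nlinarith [sq_nonneg (x - y)]) zero_le_one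
    linarith
  refine (Finset.expect_le_expect fun t _ => (Finset.expect_le_expect fun s _ => h1 t s)).trans ?_
  simp only [Fintype.expect_const, Finset.expect_add_distrib, ← Finset.mul_expect]
  rw [expect_norm_add_mean_noise_sq hn hm hf]
  simp

/-- In the application `d` depends on the same samples as `b`, so their cross term does not average
out. It is paid for with a full copy of ‖b‖², whereas ‖u‖² may lose only a δ/2 share of its
contraction. -/
lemma norm_add_add_sq_le (u b d : Vec p) {δ : ℝ} (hδ : 0 < δ) :
    ‖u + b + d‖ ^ 2
      ≤ ‖u + b‖ ^ 2 + δ / 2 * ‖u‖ ^ 2 + ‖b‖ ^ 2 + (2 + 2 / δ) * ‖d‖ ^ 2 := by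
  rw [norm_add_sq_real (u + b) d, inner_add_left]
  have h1 := real_inner_le_norm u d
  have h2 := real_inner_le_norm b d
  have h3 : 2 * (‖u‖ * ‖d‖) ≤ δ / 2 * ‖u‖ ^ 2 + 2 / δ * ‖d‖ ^ 2 := by
    have h : δ / 2 * ‖u‖ ^ 2 + 2 / δ * ‖d‖ ^ 2 - 2 * (‖u‖ * ‖d‖)
        = δ / 2 * (‖u‖ - 2 / δ * ‖d‖) ^ 2 := by
      field_simp
      ring
    have : 0 ≤ δ / 2 * (‖u‖ - 2 / δ * ‖d‖) ^ 2 := by positivity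
    linarith
  nlinarith [sq_nonneg (‖b‖ - ‖d‖)]

/-- With a the input and ξ the noise, the next input is W a + (W - I) ξ plus the change of local
gradients: subtracting the previous estimator from the mixed tracker removes one unmixed copy of ξ.
-/
lemma trackingInput_step (f : Fin n → Fin m → Vec p → ℝ) (W : Matrix (Fin n) (Fin n) ℝ) (α : ℝ)
    (S : State n m p) (t s : Fin n → Fin m) (i : Fin n) :
    trackingInput f (step f W α S t s) i
      = ∑ r, W i r • trackingInput f S r
        + ∑ r, (W i r - if i = r then 1 else 0) • noise f S r (t r)
        + (gradient (localFun f i) ((step f W α S t s).x i)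
          - gradient (localFun f i) (S.x i)) := by
  have h1 : trackingInput f (step f W α S t s) i
      = trackerUpdate f W S t i - sagaEstimator f S i (t i)
        + gradient (localFun f i) ((step f W α S t s).x i) := rfl
  rw [h1, trackerUpdate_eq, sagaEstimator_eq]
  simp only [smul_add, Finset.sum_add_distrib, sub_smul, ite_smul, one_smul, zero_smul,
    Finset.sum_sub_distrib, Finset.sum_ite_eq, Finset.mem_univ, if_true]
  abel

lemma expect_average_centered_mix_sq_le (hm : 0 < m) {f : Fin n → Fin m → Vec p → ℝ} {L : ℝ}
    (hf : SmoothBounded f L) {W : Matrix (Fin n) (Fin n) ℝ} (hW : NetworkWeights W)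
    (S : State n m p) (u : Fin n → Vec p) :
    𝔼 t : Fin n → Fin m, (1 / (n : ℝ)) * ∑ i,
        ‖u i + ∑ r, (W i r - if i = r then 1 else 0) • noise f S r (t r)‖ ^ 2
      ≤ (1 / (n : ℝ)) * ∑ i, ‖u i‖ ^ 2 + 2 * noiseVar f S := by
  have : NeZero m := ⟨hm.ne'⟩
  rw [← Finset.mul_expect, Finset.expect_sum_comm]
  have h1 : ∀ i, 𝔼 t : Fin n → Fin m,
      ‖u i + ∑ r, (W i r - if i = r then 1 else 0) • noise f S r (t r)‖ ^ 2
      = ‖u i‖ ^ 2 + ∑ r, (W i r - if i = r then 1 else 0) ^ 2 * 𝔼 j, ‖noise f S r j‖ ^ 2 :=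
    fun i => expect_norm_add_sum_sq (u i) _ (sum_noise hm hf S)
  simp only [h1]
  rw [Finset.sum_add_distrib, Finset.sum_comm, mul_add]
  have h2 : ∑ r, ∑ i, (W i r - if i = r then 1 else 0) ^ 2 * 𝔼 j, ‖noise f S r j‖ ^ 2
      ≤ ∑ r, 2 * 𝔼 j, ‖noise f S r j‖ ^ 2 := by
    refine Finset.sum_le_sum fun r _ => ?_
    rw [← Finset.sum_mul]
    exact mul_le_mul_of_nonneg_right (sum_sq_sub_one_le hW r)
      (Finset.expect_nonneg fun _ _ => sq_nonneg _)
  rw [← Finset.mul_sum] at h2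
  have h3 := mul_le_mul_of_nonneg_left h2 (by positivity : 0 ≤ 1 / (n : ℝ))
  unfold noiseVar
  linarith

lemma expect_dispersion_trackingInput_step_le (hn : 0 < n) (hm : 0 < m)
    {f : Fin n → Fin m → Vec p → ℝ} {L : ℝ}
    (hf : SmoothBounded f L) {W : Matrix (Fin n) (Fin n) ℝ} (hW : NetworkWeights W)
    {S : State n m p} (hS : Balanced S) (α : ℝ) {l : ℝ} (hl : l = secondSingularValue W) :
    𝔼 t, 𝔼 s, dispersion (trackingInput f (step f W α S t s))
      ≤ (1 + l ^ 2) / 2 * dispersion (trackingInput f S) + 4 * noiseVar f S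
        + 4 / (1 - l ^ 2) * L ^ 2 * (α ^ 2 * (‖meanGrad f S‖ ^ 2 + noiseVar f S / n)
          + 2 * dispersion S.x + 2 * 𝔼 t, 𝔼 s, dispersion (step f W α S t s).x) := by
  have : NeZero m := ⟨hm.ne'⟩
  have hl0 : 0 ≤ l := hl ▸ secondSingularValue_nonneg W
  have hl1 : l < 1 := hl ▸ hW.singular_lt_one
  have hd : 0 < 1 - l ^ 2 := by nlinarith
  have hd1 : 1 - l ^ 2 ≤ 1 := by nlinarith
  set a := trackingInput f S with ha
  set v : Fin n → Vec p := fun i => ∑ r, W i r • a r with hv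
  set u : Fin n → Vec p := fun i => v i - mean v with hu
  set b : (Fin n → Fin m) → Fin n → Vec p := fun t i =>
    ∑ r, (W i r - if i = r then (1 : ℝ) else 0) • noise f S r (t r) with hb
  have hu2 : (1 / (n : ℝ)) * ∑ i, ‖u i‖ ^ 2 ≤ l ^ 2 * dispersion a := by
    rw [hl]
    exact dispersion_mix_le hn hW a
  -- The summand `0 + b t i` matches `expect_average_centered_mix_sq_le` with `u = 0`. The two noise
  -- averages contribute 2 `noiseVar` each, whence the coefficient 4.
  have hpt : ∀ t s, dispersion (trackingInput f (step f W α S t s))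
      ≤ (1 / (n : ℝ)) * ∑ i, ‖u i + b t i‖ ^ 2
        + (1 - l ^ 2) / 2 * ((1 / (n : ℝ)) * ∑ i, ‖u i‖ ^ 2)
        + (1 / (n : ℝ)) * ∑ i, ‖(0 : Vec p) + b t i‖ ^ 2
        + 4 / (1 - l ^ 2) * L ^ 2 *
          ((1 / (n : ℝ)) * ∑ i, ‖(step f W α S t s).x i - S.x i‖ ^ 2) := by
    intro t s
    refine (dispersion_le hn _ (mean v)).trans ?_
    have h1 : ∀ i, ‖trackingInput f (step f W α S t s) i - mean v‖ ^ 2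
        ≤ ‖u i + b t i‖ ^ 2 + (1 - l ^ 2) / 2 * ‖u i‖ ^ 2 + ‖(0 : Vec p) + b t i‖ ^ 2
          + 4 / (1 - l ^ 2) * L ^ 2 * ‖(step f W α S t s).x i - S.x i‖ ^ 2 := by
      intro i
      set e := gradient (localFun f i) ((step f W α S t s).x i)
        - gradient (localFun f i) (S.x i) with he
      have h2 : trackingInput f (step f W α S t s) i - mean v = u i + b t i + e := by
        rw [trackingInput_step]
        change v i + b t i + e - mean v = v i - mean v + b t i + e
        abel
      have h3 : ‖e‖ ^ 2 ≤ L ^ 2 * ‖(step f W α S t s).x i - S.x i‖ ^ 2 :=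
        norm_sq_le_of_norm_le (norm_gradient_localFun_sub_le hm hf i _ _)
      have h4 := norm_add_add_sq_le (u i) (b t i) e hd
      have h5 : 2 + 2 / (1 - l ^ 2) ≤ 4 / (1 - l ^ 2) := by
        rw [← sub_nonneg]
        have : 4 / (1 - l ^ 2) - (2 + 2 / (1 - l ^ 2)) = 2 * (1 - (1 - l ^ 2)) / (1 - l ^ 2) := by
          field_simp
          ring
        rw [this]
        exact div_nonneg (by linarith) hd.le
      have h6 := mul_le_mul_of_nonneg_right h5 (sq_nonneg ‖e‖)
      have h7 := mul_le_mul_of_nonneg_left h3 (by positivity : 0 ≤ 4 / (1 - l ^ 2))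
      rw [h2, zero_add]
      linarith
    have h8 := mul_le_mul_of_nonneg_left
      (Finset.sum_le_sum fun i (_ : i ∈ (Finset.univ : Finset (Fin n))) => h1 i)
      (by positivity : 0 ≤ 1 / (n : ℝ))
    refine h8.trans (le_of_eq ?_)
    simp only [Finset.sum_add_distrib, ← Finset.mul_sum]
    ring
  refine (Finset.expect_le_expect fun t _ => (Finset.expect_le_expect fun s _ => hpt t s)).trans ?_
  have e1 := expect_average_centered_mix_sq_le hm hf hW S u
  have e2 := expect_average_centered_mix_sq_le hm hf hW S (fun _ => 0)
  have e3 := mul_le_mul_of_nonneg_left (expect_norm_step_sub_sq_le hn hm hf hW hS α)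
    (by positivity : 0 ≤ 4 / (1 - l ^ 2) * L ^ 2)
  rw [Finset.mul_expect] at e3
  simp only [Finset.mul_expect] at e3
  simp only [Fintype.expect_const, Finset.expect_add_distrib]
  simp only [norm_zero, ne_eq, OfNat.ofNat_ne_zero, not_false_eq_true, zero_pow,
    Finset.sum_const_zero, mul_zero] at e2
  have h9 := mul_le_mul_of_nonneg_left hu2 (by linarith : 0 ≤ 1 + (1 - l ^ 2) / 2)
  have h10 : (1 + (1 - l ^ 2) / 2) * (l ^ 2 * dispersion a)
      ≤ (1 + l ^ 2) / 2 * dispersion a := by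
    have : (1 + l ^ 2) / 2 - (1 + (1 - l ^ 2) / 2) * l ^ 2 = (1 - l ^ 2) ^ 2 / 2 := by ring
    nlinarith [mul_nonneg (sq_nonneg (1 - l ^ 2)) (dispersion_nonneg a)]
  simp only [Finset.mul_expect] at e1 e2 e3 ⊢
  linarith

end OneStepConsensus

/-! ### The law of the random state. -/

section Law

variable {n m p : ℕ} {Ω : Type*}

lemma run_congr (f : Fin n → Fin m → Vec p → ℝ) (W : Matrix (Fin n) (Fin n) ℝ) (α : ℝ)
    (x0 : Vec p) {t t' s s' : ℕ → Fin n → Fin m} (k : ℕ)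
    (ht : ∀ l < k, t l = t' l) (hs : ∀ l < k, s l = s' l) :
    run f W α x0 t s k = run f W α x0 t' s' k := by
  induction k with
  | zero => rfl
  | succ k ih =>
    rw [run, run, ih (fun l hl => ht l (hl.trans k.lt_succ_self))
      (fun l hl => hs l (hl.trans k.lt_succ_self)), ht k k.lt_succ_self, hs k k.lt_succ_self]

/-- The labels of the samples drawn in the iterations `l ∈ I`. -/
def sampleLabels (n : ℕ) (I : Finset ℕ) : Finset ((ℕ × Fin n) ⊕ (ℕ × Fin n)) :=
  (I ×ˢ Finset.univ).disjSum (I ×ˢ Finset.univ)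

/-- The whole family of samples. -/
def samples (τ s : ℕ → Fin n → Ω → Fin m) : (ℕ × Fin n) ⊕ (ℕ × Fin n) → Ω → Fin m :=
  Sum.elim (fun q : ℕ × Fin n => τ q.1 q.2) (fun q : ℕ × Fin n => s q.1 q.2)

/-- The random state after `k` iterations. -/
noncomputable def randomState (f : Fin n → Fin m → Vec p → ℝ) (W : Matrix (Fin n) (Fin n) ℝ)
    (α : ℝ) (x0 : Vec p) (τ s : ℕ → Fin n → Ω → Fin m) (k : ℕ) (ω : Ω) : State n m p :=
  run f W α x0 (fun k i => τ k i ω) (fun k i => s k i ω) k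

/-- Factoring the state through finitely many finite-valued samples makes every functional of it
measurable and integrable, with no σ-algebra on `State`. -/
lemma exists_randomState_eq (hm : 0 < m) (f : Fin n → Fin m → Vec p → ℝ)
    (W : Matrix (Fin n) (Fin n) ℝ) (α : ℝ) (x0 : Vec p) (τ s : ℕ → Fin n → Ω → Fin m) (k : ℕ) :
    ∃ Φ : (sampleLabels n (Finset.range k) → Fin m) → State n m p,
      ∀ ω, randomState f W α x0 τ s k ω = Φ fun q => samples τ s q ω := by
  classical
  -- The default index 0 fills the samples of iterations ≥ k, which the first k steps never read.
  refine ⟨fun h => run f W α x0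
    (fun l i => if hl : Sum.inl (l, i) ∈ sampleLabels n (Finset.range k)
      then h ⟨_, hl⟩ else ⟨0, hm⟩)
    (fun l i => if hl : Sum.inr (l, i) ∈ sampleLabels n (Finset.range k)
      then h ⟨_, hl⟩ else ⟨0, hm⟩) k, fun ω => run_congr f W α x0 k ?_ ?_⟩
  · intro l hl
    funext i
    have : Sum.inl (l, i) ∈ sampleLabels n (Finset.range k) := by simp [sampleLabels, hl]
    simp [this, samples]
  · intro l hl
    funext i
    have : Sum.inr (l, i) ∈ sampleLabels n (Finset.range k) := by simp [sampleLabels, hl]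
    simp [this, samples]

lemma balanced_randomState {f : Fin n → Fin m → Vec p → ℝ}
    {W : Matrix (Fin n) (Fin n) ℝ} (hW : NetworkWeights W) (α : ℝ) (x0 : Vec p)
    (τ s : ℕ → Fin n → Ω → Fin m) (k : ℕ) (ω : Ω) :
    Balanced (randomState f W α x0 τ s k ω) := by
  unfold randomState
  induction k with
  | zero => rfl
  | succ k ih => exact balanced_step hW ih _ _ _

variable [MeasurableSpace Ω] {P : Measure Ω}

lemma measurable_samples {τ s : ℕ → Fin n → Ω → Fin m} (hs : IndependentSampling P τ s)
    (q : (ℕ × Fin n) ⊕ (ℕ × Fin n)) : Measurable (samples τ s q) := by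
  rcases q with q | q
  · exact hs.measurable_tau _ _
  · exact hs.measurable_s _ _

lemma measure_samples_eq {τ s : ℕ → Fin n → Ω → Fin m} (hs : IndependentSampling P τ s) (k : ℕ)
    (t u : Fin n → Fin m) :
    P.real {ω | (fun i => τ k i ω) = t ∧ (fun i => s k i ω) = u} = (1 / (m : ℝ)) ^ (2 * n) := by
  set sets : (ℕ × Fin n) ⊕ (ℕ × Fin n) → Set (Fin m) :=
    Sum.elim (fun q => {t q.2}) (fun q => {u q.2}) with hsets
  have h1 : {ω | (fun i => τ k i ω) = t ∧ (fun i => s k i ω) = u}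
      = ⋂ q ∈ sampleLabels n {k}, samples τ s q ⁻¹' sets q := by
    ext ω
    simp [sampleLabels, samples, hsets, funext_iff]
  have h2 := hs.indep.measure_inter_preimage_eq_mul (S := sampleLabels n {k}) (sets := sets)
    (fun q _ => MeasurableSet.of_discrete)
  have h3 : ∀ q ∈ sampleLabels n {k}, P (samples τ s q ⁻¹' sets q) = (m : ℝ≥0∞)⁻¹ := by
    rintro (q | q) _
    · exact hs.uniform_tau _ _ _
    · exact hs.uniform_s _ _ _
  have h4 : (sampleLabels n {k}).card = 2 * n := by
    simp [sampleLabels]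
    ring
  rw [Measure.real, h1]
  change (P (⋂ q ∈ sampleLabels n {k}, samples τ s q ⁻¹' sets q)).toReal = _
  have h5 : P (⋂ q ∈ sampleLabels n {k}, samples τ s q ⁻¹' sets q)
      = ∏ q ∈ sampleLabels n {k}, P (samples τ s q ⁻¹' sets q) := h2
  rw [h5, Finset.prod_congr rfl h3, Finset.prod_const, h4]
  simp

lemma indepFun_past_present {τ s : ℕ → Fin n → Ω → Fin m} (hs : IndependentSampling P τ s)
    (k : ℕ) :
    IndepFun (fun ω (q : sampleLabels n (Finset.range k)) => samples τ s q ω)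
      (fun ω (q : sampleLabels n {k}) => samples τ s q ω) P := by
  refine iIndepFun.indepFun_finset _ _ ?_ hs.indep (measurable_samples hs)
  rw [Finset.disjoint_left]
  rintro (⟨l, i⟩ | ⟨l, i⟩) h1 h2 <;> simp [sampleLabels] at h1 h2 <;> omega

variable [IsProbabilityMeasure P]

lemma integrable_comp_of_finite {β : Type*} [Finite β] [MeasurableSpace β]
    [DiscreteMeasurableSpace β] {X : Ω → β} (hX : Measurable X) (g : β → ℝ) :
    Integrable (fun ω => g (X ω)) P := by
  have := Measure.isProbabilityMeasure_map (μ := P) hX.aemeasurable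
  exact (Integrable.of_finite (f := g) (μ := P.map X)).comp_measurable hX

lemma integrable_randomState (hm : 0 < m) (f : Fin n → Fin m → Vec p → ℝ)
    (W : Matrix (Fin n) (Fin n) ℝ) (α : ℝ) (x0 : Vec p) {τ s : ℕ → Fin n → Ω → Fin m}
    (hs : IndependentSampling P τ s) (k : ℕ) (g : State n m p → ℝ) :
    Integrable (fun ω => g (randomState f W α x0 τ s k ω)) P := by
  obtain ⟨Φ, hΦ⟩ := exists_randomState_eq hm f W α x0 τ s k
  simp only [hΦ]
  exact integrable_comp_of_finite
    (X := fun ω (q : sampleLabels n (Finset.range k)) => samples τ s q ω)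
    (measurable_pi_lambda _ fun q => measurable_samples hs q) (fun h => g (Φ h))

/-- This replaces conditional expectation. The integral is split over the m^(2n) equally likely
values of the current samples, and the indicator of each value is independent of the past state. -/
lemma integral_randomState_step (hm : 0 < m) (f : Fin n → Fin m → Vec p → ℝ)
    (W : Matrix (Fin n) (Fin n) ℝ) (α : ℝ) (x0 : Vec p) {τ s : ℕ → Fin n → Ω → Fin m}
    (hs : IndependentSampling P τ s) (k : ℕ) (g : State n m p → ℝ) :
    ∫ ω, g (randomState f W α x0 τ s (k + 1) ω) ∂P
      = ∫ ω, 𝔼 t, 𝔼 u, g (step f W α (randomState f W α x0 τ s k ω) t u) ∂P := by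
  classical
  have hm' : (m : ℝ) ≠ 0 := by exact_mod_cast hm.ne'
  set cur : Ω → (Fin n → Fin m) × (Fin n → Fin m) :=
    fun ω => (fun i => τ k i ω, fun i => s k i ω) with hcur
  have hcurm : Measurable cur :=
    (measurable_pi_lambda _ fun i => hs.measurable_tau k i).prodMk
      (measurable_pi_lambda _ fun i => hs.measurable_s k i)
  obtain ⟨Φ, hΦ⟩ := exists_randomState_eq hm f W α x0 τ s k
  have hlabel1 : ∀ i, Sum.inl (k, i) ∈ sampleLabels n {k} := by simp [sampleLabels]
  have hlabel2 : ∀ i, Sum.inr (k, i) ∈ sampleLabels n {k} := by simp [sampleLabels]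
  have hind : ∀ c : (Fin n → Fin m) × (Fin n → Fin m),
      ∫ ω, (if cur ω = c then 1 else 0) * g (step f W α (randomState f W α x0 τ s k ω) c.1 c.2) ∂P
        = (1 / (m : ℝ)) ^ (2 * n)
          * ∫ ω, g (step f W α (randomState f W α x0 τ s k ω) c.1 c.2) ∂P := by
    intro c
    have hI : IndepFun (fun ω => if cur ω = c then (1 : ℝ) else 0)
        (fun ω => g (step f W α (randomState f W α x0 τ s k ω) c.1 c.2)) P := by
      have h := (indepFun_past_present hs k).symm.comp
        (φ := fun d : sampleLabels n {k} → Fin m =>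
          if ((fun i => d ⟨_, hlabel1 i⟩, fun i => d ⟨_, hlabel2 i⟩) :
            (Fin n → Fin m) × (Fin n → Fin m)) = c then (1 : ℝ) else 0)
        (ψ := fun h => g (step f W α (Φ h) c.1 c.2))
        Measurable.of_discrete Measurable.of_discrete
      simp only [hΦ]
      exact h
    have hmeas : MeasurableSet (cur ⁻¹' {c}) := hcurm (measurableSet_singleton c)
    have hprob : ∫ ω, (if cur ω = c then (1 : ℝ) else 0) ∂P = (1 / (m : ℝ)) ^ (2 * n) := by
      rw [← measure_samples_eq hs k c.1 c.2]
      have h6 : (fun ω => if cur ω = c then (1 : ℝ) else 0)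
          = (cur ⁻¹' {c}).indicator 1 := by
        funext ω
        simp [Set.indicator]
      rw [h6, integral_indicator_one hmeas]
      congr 1
      ext ω
      simp [hcur, Prod.ext_iff]
    rw [hI.integral_fun_mul_eq_mul_integral, hprob]
    · exact (integrable_comp_of_finite hcurm
        (fun d => if d = c then (1 : ℝ) else 0)).aestronglyMeasurable
    · exact (integrable_randomState hm f W α x0 hs k
        (fun S => g (step f W α S c.1 c.2))).aestronglyMeasurable
  have hsum : ∀ ω, g (randomState f W α x0 τ s (k + 1) ω)
      = ∑ c, (if cur ω = c then 1 else 0)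
        * g (step f W α (randomState f W α x0 τ s k ω) c.1 c.2) := by
    intro ω
    simp
    rfl
  have hint : ∀ c : (Fin n → Fin m) × (Fin n → Fin m),
      Integrable (fun ω => g (step f W α (randomState f W α x0 τ s k ω) c.1 c.2)) P :=
    fun c => integrable_randomState hm f W α x0 hs k (fun S => g (step f W α S c.1 c.2))
  have hexp : ∀ S : State n m p, 𝔼 t, 𝔼 u, g (step f W α S t u)
      = ∑ c : (Fin n → Fin m) × (Fin n → Fin m),
        (1 / (m : ℝ)) ^ (2 * n) * g (step f W α S c.1 c.2) := by
    intro S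
    rw [Fintype.sum_prod_type, Fintype.expect_eq_sum_div_card, Finset.sum_div]
    refine Finset.sum_congr rfl fun t _ => ?_
    rw [Fintype.expect_eq_sum_div_card, Finset.sum_div, Finset.sum_div]
    refine Finset.sum_congr rfl fun u _ => ?_
    simp only [Fintype.card_pi, Fintype.card_fin, Finset.prod_const, Finset.card_univ,
      Nat.cast_pow]
    rw [two_mul, pow_add, one_div, inv_pow]
    ring
  simp only [hsum, hexp]
  rw [integral_finsetSum, integral_finsetSum]
  · refine Finset.sum_congr rfl fun c _ => ?_
    rw [hind c, integral_const_mul]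
  · exact fun c _ => (hint c).const_mul _
  · intro c _
    have h7 : (fun ω => (if cur ω = c then (1 : ℝ) else 0)
        * g (step f W α (randomState f W α x0 τ s k ω) c.1 c.2))
        = (cur ⁻¹' {c}).indicator
          fun ω => g (step f W α (randomState f W α x0 τ s k ω) c.1 c.2) := by
      funext ω
      simp [Set.indicator]
    rw [h7]
    exact (hint c).indicator (hcurm (measurableSet_singleton c))

end Law

/-! ### Summation of the coupled recursions. -/

section Recursions

/-- The left sum includes index K, so that it also dominates shifted sums of `u (k + 1)`. -/
lemma sum_range_le_of_recursion {u w : ℕ → ℝ} {q : ℝ} (hq : 0 ≤ q) (hu : ∀ k, 0 ≤ u k)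
    (h : ∀ k, u (k + 1) ≤ q * u k + w k) (K : ℕ) :
    (1 - q) * ∑ k ∈ Finset.range (K + 1), u k ≤ u 0 + ∑ k ∈ Finset.range K, w k := by
  have h1 : ∑ k ∈ Finset.range (K + 1), u k
      ≤ q * ∑ k ∈ Finset.range K, u k + ∑ k ∈ Finset.range K, w k + u 0 := by
    rw [Finset.sum_range_succ', Finset.mul_sum, ← Finset.sum_add_distrib]
    gcongr with k
    exact h k
  have h2 : ∑ k ∈ Finset.range K, u k ≤ ∑ k ∈ Finset.range (K + 1), u k := by
    rw [Finset.sum_range_succ]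
    linarith [hu K]
  nlinarith [mul_le_mul_of_nonneg_left h2 hq]

lemma sum_range_descent {F w : ℕ → ℝ} (h : ∀ k, F (k + 1) ≤ F k - w k) (K : ℕ) :
    ∑ k ∈ Finset.range K, w k ≤ F 0 - F K := by
  rw [← Finset.sum_range_sub']
  exact Finset.sum_le_sum fun k _ => by linarith [h k]

/-- The step-size conditions, in terms of `a = α L`, that the analysis uses. -/
structure StepCondition (n m l a : ℝ) : Prop where
  pos : 0 < a
  le_half : a ≤ 1 / 2
  cube_le : a ^ 3 * m ^ 2 ≤ 8 / 2197 * n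
  mul_le : l * a ≤ (1 - l ^ 2) ^ 2 / 48
  fourth_le : l ^ 2 * a ^ 4 * m ^ 2 ≤ (1 - l ^ 2) ^ 3 / 104976

/-- Compare cubes: (a²m)³ ≤ (a³m²)² ≤ (8n/2197)² ≤ (4n/169)³, where m ≥ 1 and n ≥ 1 give the outer
inequalities. -/
lemma StepCondition.sq_mul_le {n m l a : ℝ} (h : StepCondition n m l a) (hn : 1 ≤ n)
    (hm : 1 ≤ m) : a ^ 2 * m ≤ 4 / 169 * n := by
  have h1 : 0 ≤ a ^ 3 * m ^ 2 := by have := h.pos; positivity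
  have h2 : (a ^ 2 * m) ^ 3 ≤ (4 / 169 * n) ^ 3 := by
    have h3 : (a ^ 3 * m ^ 2) ^ 2 ≤ (8 / 2197 * n) ^ 2 := pow_le_pow_left₀ h1 h.cube_le 2
    have h4 : (a ^ 2 * m) ^ 3 ≤ (a ^ 3 * m ^ 2) ^ 2 := by
      have : (a ^ 3 * m ^ 2) ^ 2 - (a ^ 2 * m) ^ 3 = (a ^ 2 * m) ^ 3 * (m - 1) := by ring
      have : 0 ≤ (a ^ 2 * m) ^ 3 * (m - 1) :=
        mul_nonneg (by positivity) (by linarith)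
      linarith
    have h5 : (8 / 2197 * n) ^ 2 ≤ (4 / 169 * n) ^ 3 := by
      have : (4 / 169 * n) ^ 3 - (8 / 2197 * n) ^ 2 = 64 / 4826809 * (n ^ 2 * (n - 1)) := by ring
      have : 0 ≤ n ^ 2 * (n - 1) := mul_nonneg (by positivity) (by linarith)
      linarith
    linarith
  exact le_of_pow_le_pow_left₀ (by norm_num) (by positivity) h2

/-- The recursive inequalities satisfied by the expectations of the descent quantities. -/
structure DescentSystem (n m l α L Fs : ℝ) (F N G X T V A : ℕ → ℝ) : Prop where
  lower : ∀ k, Fs ≤ F k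
  N_nonneg : ∀ k, 0 ≤ N k
  G_nonneg : ∀ k, 0 ≤ G k
  X_nonneg : ∀ k, 0 ≤ X k
  T_nonneg : ∀ k, 0 ≤ T k
  V_nonneg : ∀ k, 0 ≤ V k
  A_nonneg : ∀ k, 0 ≤ A k
  X_zero : X 0 = 0
  T_zero : T 0 = 0
  V_le : ∀ k, V k ≤ 2 * L ^ 2 * (X k + T k)
  F_succ : ∀ k, F (k + 1) ≤ F k - α / 2 * N k - α / 2 * (1 - α * L) * G k
    + α / 2 * L ^ 2 * X k + L * α ^ 2 / 2 * (V k / n)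
  T_succ : ∀ k, T (k + 1) ≤ (1 - 1 / (2 * m)) * T k + X k / m + 2 * m * α ^ 2 * G k
    + α ^ 2 * (V k / n)
  X_succ : ∀ k, X (k + 1) ≤ (1 + l ^ 2) / 2 * X k
    + 2 * l ^ 4 * α ^ 2 / (1 - l ^ 2) * (A k + V k)
  A_succ : ∀ k, A (k + 1) ≤ (1 + l ^ 2) / 2 * A k + 4 * V k
    + 4 / (1 - l ^ 2) * L ^ 2 * (α ^ 2 * (G k + V k / n) + 2 * X k + 2 * X (k + 1))

variable {n m l α L Fs : ℝ} {F N G X T V A : ℕ → ℝ}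

/-- Inserting V ≤ 2L²(X + T) into the table recursion costs 8/(169m) of its contraction 1/(2m),
which leaves 153/(338m). Summing and inserting the result into the bound on V gives 7 and 9 after
rounding up. -/
lemma DescentSystem.sum_V_le (h : DescentSystem n m l α L Fs F N G X T V A)
    (hs : StepCondition n m l (α * L)) (hn : 1 ≤ n) (hm : 1 ≤ m) (K : ℕ) :
    ∑ k ∈ Finset.range K, V k
      ≤ 7 * (L ^ 2 * ∑ k ∈ Finset.range (K + 1), X k)
        + 9 * m ^ 2 * (α * L) ^ 2 * ∑ k ∈ Finset.range K, G k := by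
  have hn0 : 0 < n := by linarith
  have hm0 : 0 < m := by linarith
  have hq : 0 ≤ 1 - 153 / (338 * m) := by
    rw [sub_nonneg, div_le_one (by positivity)]
    linarith
  have hrec : ∀ k, T (k + 1) ≤ (1 - 153 / (338 * m)) * T k
      + (177 / 169 * (X k / m) + 2 * m * α ^ 2 * G k) := by
    intro k
    have h1 := h.T_succ k
    have h2 : α ^ 2 * (V k / n) ≤ 8 / (169 * m) * (X k + T k) := by
      have h3 : α ^ 2 * (V k / n) ≤ α ^ 2 * (2 * L ^ 2 * (X k + T k) / n) := by
        gcongr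
        exact h.V_le k
      have h4 := hs.sq_mul_le hn hm
      have h5 : α ^ 2 * (2 * L ^ 2 * (X k + T k) / n)
          = 2 * ((α * L) ^ 2 * m) * ((X k + T k) / (n * m)) := by
        field_simp
      have h6 : 0 ≤ (X k + T k) / (n * m) :=
        div_nonneg (add_nonneg (h.X_nonneg k) (h.T_nonneg k)) (by positivity)
      have h7 : 2 * ((α * L) ^ 2 * m) * ((X k + T k) / (n * m))
          ≤ 2 * (4 / 169 * n) * ((X k + T k) / (n * m)) := by gcongr
      have h8 : 2 * (4 / 169 * n) * ((X k + T k) / (n * m)) = 8 / (169 * m) * (X k + T k) := by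
        field_simp
        ring
      linarith
    have h9 : (1 - 1 / (2 * m)) * T k + X k / m + 8 / (169 * m) * (X k + T k)
        = (1 - 153 / (338 * m)) * T k + 177 / 169 * (X k / m) := by
      field_simp
      ring
    linarith
  have hsum := sum_range_le_of_recursion hq h.T_nonneg hrec K
  rw [h.T_zero, Finset.sum_add_distrib, ← Finset.mul_sum, ← Finset.mul_sum, ← Finset.sum_div]
    at hsum
  have hX : ∑ k ∈ Finset.range K, X k ≤ ∑ k ∈ Finset.range (K + 1), X k := by
    rw [Finset.sum_range_succ]
    linarith [h.X_nonneg K]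
  have hT : ∑ k ∈ Finset.range K, T k ≤ ∑ k ∈ Finset.range (K + 1), T k := by
    rw [Finset.sum_range_succ]
    linarith [h.T_nonneg K]
  have hG : 0 ≤ ∑ k ∈ Finset.range K, G k := Finset.sum_nonneg fun k _ => h.G_nonneg k
  have hX0 : 0 ≤ ∑ k ∈ Finset.range K, X k := Finset.sum_nonneg fun k _ => h.X_nonneg k
  have hV : ∑ k ∈ Finset.range K, V k
      ≤ 2 * L ^ 2 * (∑ k ∈ Finset.range K, X k + ∑ k ∈ Finset.range K, T k) := by
    rw [← Finset.sum_add_distrib, Finset.mul_sum]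
    exact Finset.sum_le_sum fun k _ => h.V_le k
  set sX := ∑ k ∈ Finset.range K, X k
  set sX1 := ∑ k ∈ Finset.range (K + 1), X k
  set sT := ∑ k ∈ Finset.range K, T k
  set sT1 := ∑ k ∈ Finset.range (K + 1), T k
  set sG := ∑ k ∈ Finset.range K, G k
  have hT2 : sT1 ≤ 354 / 153 * sX + 676 / 153 * (m ^ 2 * α ^ 2 * sG) := by
    have e1 : sT1 = 338 * m / 153 * ((1 - (1 - 153 / (338 * m))) * sT1) := by
      field_simp
      ring
    rw [e1]
    refine (mul_le_mul_of_nonneg_left hsum (by positivity)).trans (le_of_eq ?_)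
    field_simp
    ring
  have hmG : 0 ≤ m ^ 2 * α ^ 2 * sG := by positivity
  have hT3 : sX + sT ≤ 7 / 2 * sX1 + 9 / 2 * (m ^ 2 * α ^ 2 * sG) := by linarith
  have := mul_le_mul_of_nonneg_left hT3 (by positivity : 0 ≤ 2 * L ^ 2)
  refine hV.trans (this.trans (le_of_eq ?_))
  ring

lemma DescentSystem.sum_consensus_le (h : DescentSystem n m l α L Fs F N G X T V A)
    (hs : StepCondition n m l (α * L)) (hn : 1 ≤ n) (hm : 1 ≤ m) (hl0 : 0 ≤ l) (hl1 : l < 1)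
    (K : ℕ) :
    L ^ 2 * ∑ k ∈ Finset.range (K + 1), X k
      ≤ 1 / 250 * (l ^ 2 * (1 - l ^ 2) * A 0) + 1 / 100 * ∑ k ∈ Finset.range K, G k := by
  have hn0 : 0 < n := by linarith
  have hm0 : 0 < m := by linarith
  have hd : 0 < 1 - l ^ 2 := by nlinarith
  have hV := h.sum_V_le hs hn hm K
  have hXs := sum_range_le_of_recursion (by positivity : 0 ≤ (1 + l ^ 2) / 2) h.X_nonneg h.X_succ K
  have hAs := sum_range_le_of_recursion (u := A) (q := (1 + l ^ 2) / 2)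
    (w := fun k => 4 * V k + 4 / (1 - l ^ 2) * L ^ 2
      * (α ^ 2 * (G k + V k / n) + 2 * X k + 2 * X (k + 1)))
    (by positivity) h.A_nonneg (fun k => by linarith [h.A_succ k]) K
  have hX : ∑ k ∈ Finset.range K, X k ≤ ∑ k ∈ Finset.range (K + 1), X k := by
    rw [Finset.sum_range_succ]
    linarith [h.X_nonneg K]
  have hX' : ∑ k ∈ Finset.range K, X (k + 1) ≤ ∑ k ∈ Finset.range (K + 1), X k := by
    rw [Finset.sum_range_succ']
    linarith [h.X_nonneg 0]
  have hA' : ∑ k ∈ Finset.range K, A k ≤ ∑ k ∈ Finset.range (K + 1), A k := by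
    rw [Finset.sum_range_succ]
    linarith [h.A_nonneg K]
  have hG : 0 ≤ ∑ k ∈ Finset.range K, G k := Finset.sum_nonneg fun k _ => h.G_nonneg k
  have hX0 : 0 ≤ ∑ k ∈ Finset.range (K + 1), X k := Finset.sum_nonneg fun k _ => h.X_nonneg k
  have hV0 : 0 ≤ ∑ k ∈ Finset.range K, V k := Finset.sum_nonneg fun k _ => h.V_nonneg k
  simp only [Finset.sum_add_distrib, ← Finset.mul_sum, ← Finset.sum_div] at hXs hAs
  rw [h.X_zero, zero_add] at hXs
  have hl2 : l ^ 2 ≤ 1 := by linarith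
  have hδ1 : 1 - l ^ 2 ≤ 1 := by linarith [sq_nonneg l]
  have hl4 : l ^ 2 * (1 - l ^ 2) ≤ 1 / 4 := by linarith [sq_nonneg (l ^ 2 - 1 / 2)]
  have hhalf : 1 - (1 + l ^ 2) / 2 = (1 - l ^ 2) / 2 := by ring
  rw [hhalf] at hXs hAs
  set sX := ∑ k ∈ Finset.range K, X k
  set sX' := ∑ k ∈ Finset.range K, X (k + 1)
  set sX1 := ∑ k ∈ Finset.range (K + 1), X k
  set sA := ∑ k ∈ Finset.range K, A k
  set sA1 := ∑ k ∈ Finset.range (K + 1), A k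
  set sV := ∑ k ∈ Finset.range K, V k
  set g := ∑ k ∈ Finset.range K, G k
  set δ := 1 - l ^ 2 with hδ
  set a := α * L with ha
  set x := L ^ 2 * sX1 with hx
  have hx0 : 0 ≤ x := by positivity
  have ha0 := hs.pos
  have hA00 := h.A_nonneg 0
  have ha2 : a ^ 2 ≤ 1 / 4 := by
    have := pow_le_pow_left₀ ha0.le hs.le_half 2
    norm_num at this ⊢
    exact this
  have ha2n : a ^ 2 ≤ 4 / 169 * n :=
    (le_mul_of_one_le_right (sq_nonneg a) hm).trans (hs.sq_mul_le hn hm)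
  -- The coefficients round up 1/4 + 9·4/2197 for g and 4 + 7·4/169 for x.
  have hD : L ^ 2 * (α ^ 2 * (g + sV / n) + 2 * sX + 2 * sX') ≤ 27 / 100 * g + 417 / 100 * x := by
    have e1 : L ^ 2 * (α ^ 2 * (g + sV / n) + 2 * sX + 2 * sX')
        ≤ a ^ 2 * g + a ^ 2 / n * sV + 4 * x := by
      have : L ^ 2 * (2 * sX + 2 * sX') ≤ L ^ 2 * (4 * sX1) := by
        apply mul_le_mul_of_nonneg_left _ (sq_nonneg L)
        linarith
      have e : L ^ 2 * (α ^ 2 * (g + sV / n) + 2 * sX + 2 * sX')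
        = a ^ 2 * g + a ^ 2 / n * sV + L ^ 2 * (2 * sX + 2 * sX') := by
        rw [ha]; ring
      rw [e, hx]
      linarith
    have e2 : a ^ 2 / n * sV ≤ a ^ 2 / n * (7 * x + 9 * m ^ 2 * a ^ 2 * g) := by
      gcongr
    have e3 : a ^ 2 / n ≤ 4 / 169 := by
      rw [div_le_iff₀ hn0]; exact ha2n
    have e4 : a ^ 2 / n * (m ^ 2 * a ^ 2) ≤ 4 / 2197 := by
      have : a ^ 2 / n * (m ^ 2 * a ^ 2) = a * (a ^ 3 * m ^ 2) / n := by ring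
      rw [this, div_le_iff₀ hn0]
      calc a * (a ^ 3 * m ^ 2) ≤ 1 / 2 * (8 / 2197 * n) :=
            mul_le_mul hs.le_half hs.cube_le (by positivity) (by norm_num)
        _ = 4 / 2197 * n := by ring
    have e5 := mul_le_mul_of_nonneg_right e3 hx0
    have e6 := mul_le_mul_of_nonneg_right e4 hG
    have e7 := mul_le_mul_of_nonneg_right ha2 hG
    have e8 : a ^ 2 / n * (7 * x + 9 * m ^ 2 * a ^ 2 * g)
        = 7 * (a ^ 2 / n * x) + 9 * (a ^ 2 / n * (m ^ 2 * a ^ 2) * g) := by ring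
    linarith
  have hsA : sA1 ≤ 2 / δ * (A 0 + 4 * sV + 4 / δ * (27 / 100 * g + 417 / 100 * x)) := by
    have e1 : sA1 = 2 / δ * (δ / 2 * sA1) := by
      field_simp
    rw [e1]
    apply mul_le_mul_of_nonneg_left _ (by positivity)
    have e2 := mul_le_mul_of_nonneg_left hD (by positivity : 0 ≤ 4 / δ)
    linarith
  have hxx : x ≤ 4 * l ^ 4 * a ^ 2 / δ ^ 2 * (sA1 + sV) := by
    have e1 : x = 2 / δ * L ^ 2 * (δ / 2 * sX1) := by
      rw [hx]
      field_simp
    have e2 : 2 / δ * L ^ 2 * (δ / 2 * sX1)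
        ≤ 2 / δ * L ^ 2 * (2 * l ^ 4 * α ^ 2 / δ * (sA1 + sV)) := by
      apply mul_le_mul_of_nonneg_left _ (by positivity)
      refine hXs.trans ?_
      gcongr
    rw [e1]
    refine e2.trans (le_of_eq ?_)
    rw [ha]
    field_simp
    ring
  have hla : l ^ 2 * a ^ 2 ≤ δ ^ 4 / 2304 := by
    have := pow_le_pow_left₀ (by positivity) hs.mul_le 2
    rw [mul_pow] at this
    refine this.trans (le_of_eq ?_)
    rw [hδ]
    ring
  -- The loop gains: `c1` and `c2` come from the square of `mul_le` (48² = 2304), while `c3`, which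
  -- controls the m² amplification of the variance, needs `fourth_le`.
  have c1 : l ^ 4 * a ^ 2 / δ ^ 3 ≤ l ^ 2 * δ / 2304 := by
    rw [div_le_iff₀ (by positivity)]
    have := mul_le_mul_of_nonneg_left hla (sq_nonneg l)
    refine le_trans (le_of_eq ?_) (this.trans (le_of_eq ?_)) <;> ring
  have c2 : l ^ 4 * a ^ 2 / δ ^ 4 ≤ 1 / 2304 := by
    rw [div_le_iff₀ (by positivity)]
    have h1 := mul_le_mul_of_nonneg_left hla (sq_nonneg l)
    have h3 := mul_le_mul_of_nonneg_right hl2 (by positivity : 0 ≤ δ ^ 4 / 2304)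
    linarith
  have c3 : l ^ 4 * a ^ 2 / δ ^ 3 * (m ^ 2 * a ^ 2) ≤ 1 / 104976 := by
    have h3 := mul_le_mul hl2 hs.fourth_le (by positivity) zero_le_one
    rw [div_mul_eq_mul_div, div_le_iff₀ (by positivity)]
    refine le_trans (le_of_eq ?_) (h3.trans (le_of_eq ?_))
    · ring
    · rw [hδ]; ring
  have d1 : 4 * l ^ 4 * a ^ 2 / δ ^ 2 * (sA1 + sV)
      ≤ 4 * l ^ 4 * a ^ 2 / δ ^ 2 *
        (2 / δ * (A 0 + 4 * sV + 4 / δ * (27 / 100 * g + 417 / 100 * x)) + 1 / δ * sV) := by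
    gcongr
    have : 1 ≤ 1 / δ := by rw [le_div_iff₀ hd]; linarith
    exact le_mul_of_one_le_left hV0 this
  have d2 : 4 * l ^ 4 * a ^ 2 / δ ^ 2 *
        (2 / δ * (A 0 + 4 * sV + 4 / δ * (27 / 100 * g + 417 / 100 * x)) + 1 / δ * sV)
      = 8 * (l ^ 4 * a ^ 2 / δ ^ 3 * A 0) + 36 * (l ^ 4 * a ^ 2 / δ ^ 3 * sV)
        + 32 * (l ^ 4 * a ^ 2 / δ ^ 4 * (27 / 100 * g + 417 / 100 * x)) := by
    field_simp
    ring
  have d3 := mul_le_mul_of_nonneg_right c1 hA00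
  have d4 := mul_le_mul_of_nonneg_right c2
    (by positivity : 0 ≤ 27 / 100 * g + 417 / 100 * x)
  have d5 : l ^ 4 * a ^ 2 / δ ^ 3 * sV ≤ 7 * (1 / 9216) * x + 9 * (1 / 104976) * g := by
    have e1 : l ^ 4 * a ^ 2 / δ ^ 3 * sV
        ≤ l ^ 4 * a ^ 2 / δ ^ 3 * (7 * x + 9 * m ^ 2 * a ^ 2 * g) := by gcongr
    have e2 : l ^ 4 * a ^ 2 / δ ^ 3 ≤ 1 / 9216 := by linarith
    have e3 := mul_le_mul_of_nonneg_right e2 hx0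
    have e4 := mul_le_mul_of_nonneg_right c3 hG
    have e5 : l ^ 4 * a ^ 2 / δ ^ 3 * (7 * x + 9 * m ^ 2 * a ^ 2 * g)
        = 7 * (l ^ 4 * a ^ 2 / δ ^ 3 * x) + 9 * (l ^ 4 * a ^ 2 / δ ^ 3 * (m ^ 2 * a ^ 2) * g) := by
      ring
    linarith
  have hP : 0 ≤ l ^ 2 * δ * A 0 := by positivity
  -- On the right, x returns with total coefficient 36·7/9216 + 32·4.17/2304 < 0.09 and is absorbed
  -- on the left.
  linarith

/-- Since αL ≤ 1/2, the telescoped descent dissipates at least half of the sum of G. This exceeds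
the G produced by the variance and consensus sums, and the surplus also bounds the consensus sum
itself. -/
lemma DescentSystem.sum_stationarity_le (h : DescentSystem n m l α L Fs F N G X T V A)
    (hs : StepCondition n m l (α * L)) (hα : 0 < α) (hn : 1 ≤ n) (hm : 1 ≤ m) (hl0 : 0 ≤ l)
    (hl1 : l < 1) (K : ℕ) :
    ∑ k ∈ Finset.range K, N k ≤ 2 / α * (F 0 - Fs) + l ^ 2 * (1 - l ^ 2) * A 0 ∧
    L ^ 2 * ∑ k ∈ Finset.range (K + 1), X k
      ≤ 2 / α * (F 0 - Fs) + l ^ 2 * (1 - l ^ 2) * A 0 := by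
  have hn0 : 0 < n := by linarith
  have hd : 0 < 1 - l ^ 2 := by nlinarith
  have hV := h.sum_V_le hs hn hm K
  have hX := h.sum_consensus_le hs hn hm hl0 hl1 K
  have hF := sum_range_descent (F := F) (w := fun k => α / 2 * N k + α / 2 * (1 - α * L) * G k
    - α / 2 * L ^ 2 * X k - L * α ^ 2 / 2 * (V k / n)) (fun k => by linarith [h.F_succ k]) K
  have hXle : ∑ k ∈ Finset.range K, X k ≤ ∑ k ∈ Finset.range (K + 1), X k := by
    rw [Finset.sum_range_succ]
    linarith [h.X_nonneg K]
  have hG : 0 ≤ ∑ k ∈ Finset.range K, G k := Finset.sum_nonneg fun k _ => h.G_nonneg k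
  have hN : 0 ≤ ∑ k ∈ Finset.range K, N k := Finset.sum_nonneg fun k _ => h.N_nonneg k
  have hX0 : 0 ≤ ∑ k ∈ Finset.range (K + 1), X k := Finset.sum_nonneg fun k _ => h.X_nonneg k
  simp only [Finset.sum_add_distrib, Finset.sum_sub_distrib, ← Finset.mul_sum,
    ← Finset.sum_div] at hF
  set sX := ∑ k ∈ Finset.range K, X k
  set sX1 := ∑ k ∈ Finset.range (K + 1), X k
  set sV := ∑ k ∈ Finset.range K, V k
  set g := ∑ k ∈ Finset.range K, G k
  set sN := ∑ k ∈ Finset.range K, N k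
  set a := α * L with ha
  set x := L ^ 2 * sX1 with hx
  have hx0 : 0 ≤ x := by positivity
  have ha0 := hs.pos
  have hP : 0 ≤ l ^ 2 * (1 - l ^ 2) * A 0 := mul_nonneg (by positivity) (h.A_nonneg 0)
  have hF0 : 0 ≤ 2 / α * (F 0 - Fs) := mul_nonneg (by positivity) (by linarith [h.lower 0])
  have e1 : sN + (1 - a) * g ≤ 2 / α * (F 0 - Fs) + x + a / n * sV := by
    have i1 : F 0 - F K ≤ F 0 - Fs := by linarith [h.lower K]
    have i2 := mul_le_mul_of_nonneg_left (hF.trans i1) (by positivity : 0 ≤ 2 / α)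
    have i3 : 2 / α * (α / 2 * sN + α / 2 * (1 - a) * g - α / 2 * L ^ 2 * sX
        - L * α ^ 2 / 2 * (sV / n)) = sN + (1 - a) * g - L ^ 2 * sX - a / n * sV := by
      rw [ha]
      field_simp
    have i4 := mul_le_mul_of_nonneg_left hXle (sq_nonneg L)
    linarith
  have e2 : a / n * sV ≤ a / n * (7 * x + 9 * m ^ 2 * a ^ 2 * g) := by gcongr
  have e3 : a / n ≤ 1 / 2 := by
    rw [div_le_iff₀ hn0]
    linarith [hs.le_half]
  have e4 : a / n * (m ^ 2 * a ^ 2) ≤ 8 / 2197 := by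
    have : a / n * (m ^ 2 * a ^ 2) = a ^ 3 * m ^ 2 / n := by ring
    rw [this, div_le_iff₀ hn0]
    exact hs.cube_le
  have e5 := mul_le_mul_of_nonneg_right e3 hx0
  have e6 := mul_le_mul_of_nonneg_right e4 hG
  have e7 : a / n * (7 * x + 9 * m ^ 2 * a ^ 2 * g)
      = 7 * (a / n * x) + 9 * (a / n * (m ^ 2 * a ^ 2) * g) := by ring
  have e8 := mul_le_mul_of_nonneg_right hs.le_half hG
  constructor <;> linarith

end Recursions

/-! ### From the step-size threshold to polynomial conditions. -/

section StepSize

variable {n m : ℕ} {l L α : ℝ}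

/-- Third and fourth powers clear the fractional exponents: (2/13)³ = 8/2197 and 18⁴ = 104976. For l
= 0 the two conditions involving l are trivial. -/
lemma stepCondition_of_le_stepBound (hn : 0 < n) (hm : 0 < m) (hl0 : 0 ≤ l) (hl1 : l < 1)
    (hL : 0 < L) (hα : 0 < α) (h : α ≤ stepBound n m l L) :
    StepCondition (n : ℝ) m l (α * L) := by
  have hn' : (0 : ℝ) < n := by exact_mod_cast hn
  have hm' : (0 : ℝ) < m := by exact_mod_cast hm
  have hd : 0 < 1 - l ^ 2 := by nlinarith
  have ha : 0 < α * L := mul_pos hα hL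
  have hcube : α * L ≤ 2 * (n : ℝ) ^ (1 / 3 : ℝ) / (13 * (m : ℝ) ^ (2 / 3 : ℝ)) →
      (α * L) ^ 3 * (m : ℝ) ^ 2 ≤ 8 / 2197 * n := by
    intro h1
    have h2 := pow_le_pow_left₀ ha.le h1 3
    have h3 : ((n : ℝ) ^ (1 / 3 : ℝ)) ^ 3 = n := by
      rw [← Real.rpow_natCast, ← Real.rpow_mul hn'.le]
      norm_num
    have h4 : ((m : ℝ) ^ (2 / 3 : ℝ)) ^ 3 = (m : ℝ) ^ 2 := by
      rw [← Real.rpow_natCast, ← Real.rpow_mul hm'.le]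
      norm_num
    rw [div_pow, mul_pow (2 : ℝ), mul_pow (13 : ℝ), h3, h4, le_div_iff₀ (by positivity)] at h2
    linarith
  rw [stepBound, mul_one_div, le_div_iff₀ hL] at h
  split_ifs at h with hl
  · rw [le_min_iff] at h
    refine ⟨ha, h.2, hcube h.1, ?_, ?_⟩ <;> simp [hl]
  · rw [le_min_iff, le_min_iff, le_min_iff] at h
    obtain ⟨⟨h1, h2⟩, h3, h4⟩ := h
    have hlp : 0 < l := lt_of_le_of_ne hl0 (Ne.symm hl)
    refine ⟨ha, h3, hcube h2, ?_, ?_⟩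
    · rw [le_div_iff₀ (by positivity)] at h1
      linarith
    · have h5 := pow_le_pow_left₀ ha.le h4 4
      have h6 : ((1 - l ^ 2) ^ (3 / 4 : ℝ)) ^ 4 = (1 - l ^ 2) ^ 3 := by
        rw [← Real.rpow_natCast, ← Real.rpow_mul hd.le]
        norm_num
      have h7 : (l ^ (1 / 2 : ℝ)) ^ 4 = l ^ 2 := by
        rw [← Real.rpow_natCast, ← Real.rpow_mul hl0]
        norm_num
      have h8 : ((m : ℝ) ^ (1 / 2 : ℝ)) ^ 4 = (m : ℝ) ^ 2 := by
        rw [← Real.rpow_natCast, ← Real.rpow_mul hm'.le]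
        norm_num
      rw [div_pow, mul_pow (18 * _), mul_pow (18 : ℝ), h6, h7, h8, le_div_iff₀ (by positivity)] at h5
      linarith

lemma one_le_complexityFactor (n m : ℕ) (l : ℝ) : 1 ≤ complexityFactor n m l :=
  (le_max_right _ _).trans (le_max_left _ _)

/-- Since 1 - l ≤ 1 - l², the reciprocal of each term of the minimum is at most 48 E; the first term
sets the constant. -/
lemma one_div_le_stepBound (hn : 0 < n) (hm : 0 < m) (hl0 : 0 ≤ l) (hl1 : l < 1) (hL : 0 < L) :
    1 / (48 * complexityFactor n m l * L) ≤ stepBound n m l L := by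
  have hn' : (0 : ℝ) < n := by exact_mod_cast hn
  have hm' : (0 : ℝ) < m := by exact_mod_cast hm
  have hd1 : 0 < 1 - l := by linarith
  have hd2 : 1 - l ≤ 1 - l ^ 2 := by nlinarith
  have hd : 0 < 1 - l ^ 2 := by linarith
  have hE1 := one_le_complexityFactor n m l
  set E := complexityFactor n m l with hE
  have t2 : (m : ℝ) ^ (2 / 3 : ℝ) / (n : ℝ) ^ (1 / 3 : ℝ) ≤ E :=
    (le_max_left _ _).trans (le_max_left _ _)
  have t1 : l / (1 - l) ^ 2 ≤ E := (le_max_left _ _).trans (le_max_right _ _)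
  have t4 : l ^ (1 / 2 : ℝ) * (m : ℝ) ^ (1 / 2 : ℝ) / (1 - l) ^ (3 / 4 : ℝ) ≤ E :=
    (le_max_right _ _).trans (le_max_right _ _)
  have hE0 : 0 < E := by linarith
  have hnp : 0 < (n : ℝ) ^ (1 / 3 : ℝ) := by positivity
  have hmp : 0 < (m : ℝ) ^ (2 / 3 : ℝ) := by positivity
  rw [div_le_iff₀ (by positivity)] at t1 t2 t4
  have b2 : 1 / (48 * E) ≤ 2 * (n : ℝ) ^ (1 / 3 : ℝ) / (13 * (m : ℝ) ^ (2 / 3 : ℝ)) := by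
    rw [div_le_div_iff₀ (by positivity) (by positivity)]
    nlinarith [mul_pos hE0 hnp]
  have b3 : 1 / (48 * E) ≤ 1 / 2 := by
    rw [div_le_div_iff₀ (by positivity) (by positivity)]
    linarith
  rw [stepBound, mul_one_div, le_div_iff₀ hL]
  have hlhs : 1 / (48 * E * L) * L = 1 / (48 * E) := by field_simp
  rw [hlhs]
  split_ifs with hl
  · exact le_min b2 b3
  · have hlp : 0 < l := lt_of_le_of_ne hl0 (Ne.symm hl)
    refine le_min (le_min ?_ b2) (le_min b3 ?_)
    · rw [div_le_div_iff₀ (by positivity) (by positivity)]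
      have := pow_le_pow_left₀ hd1.le hd2 2
      nlinarith [mul_le_mul_of_nonneg_left this hE0.le]
    · have hp : (1 - l) ^ (3 / 4 : ℝ) ≤ (1 - l ^ 2) ^ (3 / 4 : ℝ) :=
        Real.rpow_le_rpow hd1.le hd2 (by norm_num)
      have hlr : 0 < l ^ (1 / 2 : ℝ) := by positivity
      have hmr : 0 < (m : ℝ) ^ (1 / 2 : ℝ) := by positivity
      rw [div_le_div_iff₀ (by positivity) (by positivity)]
      have h1 := mul_le_mul_of_nonneg_left hp hE0.le
      have h2 : 0 < E * (1 - l ^ 2) ^ (3 / 4 : ℝ) := by positivity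
      nlinarith

end StepSize

/-! ### Almost sure and mean convergence from summable expectations. -/

section Limits

variable {Ω : Type*} [MeasurableSpace Ω] {P : Measure Ω}

/-- By Tonelli the random series has finite expectation, hence converges almost surely, and its
terms vanish. -/
lemma ae_tendsto_zero_of_sum_integral_le {Z : ℕ → Ω → ℝ} {B : ℝ} (h0 : ∀ k ω, 0 ≤ Z k ω)
    (hint : ∀ k, Integrable (Z k) P)
    (hB : ∀ K, ∑ k ∈ Finset.range K, ∫ ω, Z k ω ∂P ≤ B) :
    (∀ᵐ ω ∂P, Tendsto (fun k => Z k ω) atTop (𝓝 0)) ∧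
      Tendsto (fun k => ∫ ω, Z k ω ∂P) atTop (𝓝 0) := by
  have hnn : ∀ k, 0 ≤ ∫ ω, Z k ω ∂P := fun k => integral_nonneg (h0 k)
  have hsum : Summable fun k => ∫ ω, Z k ω ∂P := summable_of_sum_range_le hnn hB
  refine ⟨?_, hsum.tendsto_atTop_zero⟩
  have h1 : ∫⁻ ω, ∑' k, ENNReal.ofReal (Z k ω) ∂P ≠ ⊤ := by
    rw [lintegral_tsum fun k => (hint k).aemeasurable.ennreal_ofReal]
    have h2 : ∀ k, ∫⁻ ω, ENNReal.ofReal (Z k ω) ∂P = ENNReal.ofReal (∫ ω, Z k ω ∂P) := fun k =>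
      (ofReal_integral_eq_lintegral_ofReal (hint k) (ae_of_all _ (h0 k))).symm
    simp only [h2]
    exact hsum.tsum_ofReal_ne_top
  have h3 := ae_lt_top' (AEMeasurable.tsum
    fun k => (hint k).aemeasurable.ennreal_ofReal) h1
  filter_upwards [h3] with ω hω
  have h4 := ENNReal.tendsto_atTop_zero_of_tsum_ne_top hω.ne
  have h5 := (ENNReal.tendsto_toReal ENNReal.zero_ne_top).comp h4
  simpa [Function.comp_def, ENNReal.toReal_ofReal (h0 _ ω)] using h5

lemma tendsto_zero_of_sq_le {u Z : ℕ → Ω → ℝ} {B c : ℝ} (hu : ∀ k ω, 0 ≤ u k ω)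
    (huint : ∀ k, Integrable (fun ω => u k ω ^ 2) P) (h0 : ∀ k ω, 0 ≤ Z k ω)
    (hint : ∀ k, Integrable (Z k) P) (hB : ∀ K, ∑ k ∈ Finset.range K, ∫ ω, Z k ω ∂P ≤ B)
    (hle : ∀ k ω, u k ω ^ 2 ≤ c * Z k ω) :
    (∀ᵐ ω ∂P, Tendsto (fun k => u k ω) atTop (𝓝 0)) ∧
      Tendsto (fun k => ∫ ω, u k ω ^ 2 ∂P) atTop (𝓝 0) := by
  obtain ⟨h1, h2⟩ := ae_tendsto_zero_of_sum_integral_le h0 hint hB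
  constructor
  · filter_upwards [h1] with ω hω
    have h3 : Tendsto (fun k => u k ω ^ 2) atTop (𝓝 0) :=
      squeeze_zero (fun k => sq_nonneg _) (fun k => hle k ω) (by simpa using hω.const_mul c)
    have h4 := (Real.continuous_sqrt.tendsto 0).comp h3
    simpa [Function.comp_def, Real.sqrt_sq (hu _ ω)] using h4
  · refine squeeze_zero (fun k => integral_nonneg fun ω => sq_nonneg _) (fun k => ?_)
      (by simpa using h2.const_mul c)
    rw [← integral_const_mul]
    exact integral_mono (huint k) ((hint k).const_mul c) (hle k)

end Limits

/-! ### The recursions in expectation and the resulting uniform bound. -/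

section Expectations

variable {n m p : ℕ} {Ω : Type*} [MeasurableSpace Ω] {P : Measure Ω} [IsProbabilityMeasure P]

lemma integral_randomState_succ_le (hm : 0 < m) {f : Fin n → Fin m → Vec p → ℝ}
    {W : Matrix (Fin n) (Fin n) ℝ} (hW : NetworkWeights W) (α : ℝ) (x0 : Vec p)
    {τ s : ℕ → Fin n → Ω → Fin m}
    (hs : IndependentSampling P τ s) (k : ℕ) (g ψ : State n m p → ℝ)
    (h : ∀ S, Balanced S → 𝔼 t, 𝔼 u, g (step f W α S t u) ≤ ψ S) :
    ∫ ω, g (randomState f W α x0 τ s (k + 1) ω) ∂P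
      ≤ ∫ ω, ψ (randomState f W α x0 τ s k ω) ∂P := by
  rw [integral_randomState_step hm f W α x0 hs k g]
  exact integral_mono
    (integrable_randomState hm f W α x0 hs k fun S => 𝔼 t, 𝔼 u, g (step f W α S t u))
    (integrable_randomState hm f W α x0 hs k ψ)
    fun ω => h _ (balanced_randomState hW α x0 τ s k ω)

lemma globalInf_le {f : Fin n → Fin m → Vec p → ℝ} {L : ℝ} (hf : SmoothBounded f L) (x : Vec p) :
    globalInf f ≤ globalFun f x :=
  ciInf_le hf.bddBelow x

lemma descentSystem (hn : 0 < n) (hm : 0 < m) {f : Fin n → Fin m → Vec p → ℝ} {L : ℝ}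
    (hf : SmoothBounded f L) {W : Matrix (Fin n) (Fin n) ℝ} (hW : NetworkWeights W) {α : ℝ}
    (hα : 0 < α) (x0 : Vec p) {τ s : ℕ → Fin n → Ω → Fin m} (hs : IndependentSampling P τ s)
    {l : ℝ} (hl : l = secondSingularValue W) :
    DescentSystem n m l α L (globalInf f)
      (fun k => ∫ ω, globalFun f (mean (randomState f W α x0 τ s k ω).x) ∂P)
      (fun k => ∫ ω, ‖gradient (globalFun f) (mean (randomState f W α x0 τ s k ω).x)‖ ^ 2 ∂P)
      (fun k => ∫ ω, ‖meanGrad f (randomState f W α x0 τ s k ω)‖ ^ 2 ∂P)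
      (fun k => ∫ ω, dispersion (randomState f W α x0 τ s k ω).x ∂P)
      (fun k => ∫ ω, tableGap (randomState f W α x0 τ s k ω) ∂P)
      (fun k => ∫ ω, noiseVar f (randomState f W α x0 τ s k ω) ∂P)
      (fun k => ∫ ω, dispersion (trackingInput f (randomState f W α x0 τ s k ω)) ∂P) := by
  -- As a functional of arbitrary `g`, the expectation is linear with no integrability side
  -- conditions, so `simp` can distribute it over the conditional bounds.
  set E : ℕ → (State n m p → ℝ) → ℝ := fun k g => ∫ ω, g (randomState f W α x0 τ s k ω) ∂P with hE
  have hI : ∀ k (g : State n m p → ℝ), Integrable (fun ω => g (randomState f W α x0 τ s k ω)) P :=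
    integrable_randomState hm f W α x0 hs
  have hadd : ∀ k g h, E k (fun S => g S + h S) = E k g + E k h := fun k g h =>
    integral_add (hI k g) (hI k h)
  have hsub : ∀ k g h, E k (fun S => g S - h S) = E k g - E k h := fun k g h =>
    integral_sub (hI k g) (hI k h)
  have hmul : ∀ k (c : ℝ) g, E k (fun S => c * g S) = c * E k g := fun k c g =>
    integral_const_mul _ _
  have hdiv : ∀ k (c : ℝ) g, E k (fun S => g S / c) = E k g / c := fun k c g =>
    integral_div _ _
  have hmono : ∀ k g h, (∀ S, g S ≤ h S) → E k g ≤ E k h := fun k g h hgh =>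
    integral_mono (hI k g) (hI k h) fun ω => hgh _
  have hsucc : ∀ k (g ψ : State n m p → ℝ),
      (∀ S, Balanced S → 𝔼 t, 𝔼 u, g (step f W α S t u) ≤ ψ S) → E (k + 1) g ≤ E k ψ :=
    fun k g ψ => integral_randomState_succ_le (P := P) (f := f) hm hW α x0 hs k g ψ
  have hm' : (m : ℝ) ≠ 0 := by exact_mod_cast hm.ne'
  have hmean : mean (fun _ : Fin n => x0) = x0 := mean_const hn x0
  refine
    { lower := ?_, N_nonneg := ?_, G_nonneg := ?_, X_nonneg := ?_, T_nonneg := ?_,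
      V_nonneg := ?_, A_nonneg := ?_, X_zero := ?_, T_zero := ?_, V_le := ?_, F_succ := ?_,
      T_succ := ?_, X_succ := ?_, A_succ := ?_ }
  · intro k
    have h := hmono k (fun _ => globalInf f) (fun S => globalFun f (mean S.x))
      fun S => globalInf_le hf _
    simpa [hE] using h
  · exact fun k => integral_nonneg fun ω => sq_nonneg _
  · exact fun k => integral_nonneg fun ω => sq_nonneg _
  · exact fun k => integral_nonneg fun ω => dispersion_nonneg _
  · exact fun k => integral_nonneg fun ω => tableGap_nonneg _
  · exact fun k => integral_nonneg fun ω => noiseVar_nonneg _ _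
  · exact fun k => integral_nonneg fun ω => dispersion_nonneg _
  · simp [randomState, run, initState, dispersion, hmean]
  · simp [randomState, run, initState, tableGap, hmean]
  · intro k
    have h := hmono k _ _ fun S => noiseVar_le hm hf S
    simp only [hadd, hmul] at h
    exact h
  · intro k
    have h := hsucc k (fun S => globalFun f (mean S.x)) _ fun S hS =>
      expect_globalFun_step_le hn hm hf hW hS hα
    simp only [hadd, hsub, hmul, hdiv] at h
    exact h
  · intro k
    have h := hsucc k (fun S => tableGap S) _ fun S hS =>
      expect_tableGap_step_le hn hm hf hW hS α
    simp only [hadd, hmul, hdiv] at h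
    exact h
  · intro k
    have h := hsucc k (fun S => dispersion S.x) _ fun S _ =>
      expect_dispersion_step_le hn hm hf hW S α hl
    simp only [hadd, hmul] at h
    exact h
  · intro k
    have h := hsucc k (fun S => dispersion (trackingInput f S)) _ fun S hS =>
      expect_dispersion_trackingInput_step_le hn hm hf hW hS α hl
    simp only [hadd, hmul, hdiv] at h
    -- The conditional average of the next dispersion, kept in the tracking bound, integrates to X
    -- (k + 1).
    have h1 : ∫ ω, dispersion (randomState f W α x0 τ s (k + 1) ω).x ∂P
        = E k (fun S => 𝔼 t, 𝔼 u, dispersion (step f W α S t u).x) :=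
      integral_randomState_step hm f W α x0 hs k fun S => dispersion S.x
    rw [h1]
    exact h

lemma dispersion_trackingInput_init_le (hn : 0 < n) (f : Fin n → Fin m → Vec p → ℝ) (x0 : Vec p) :
    dispersion (trackingInput f (initState n m x0))
      ≤ 1 / (n : ℝ) * ∑ i, ‖gradient (localFun f i) x0‖ ^ 2 := by
  simpa [trackingInput, initState] using
    dispersion_le hn (trackingInput f (initState n m x0)) 0

lemma sum_integral_le (hn : 0 < n) (hm : 0 < m) {f : Fin n → Fin m → Vec p → ℝ} {L : ℝ}
    (hf : SmoothBounded f L) {W : Matrix (Fin n) (Fin n) ℝ} (hW : NetworkWeights W) {α : ℝ}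
    (hα : 0 < α) (x0 : Vec p) {τ s : ℕ → Fin n → Ω → Fin m} (hs : IndependentSampling P τ s)
    {l : ℝ} (hl : l = secondSingularValue W) (hαb : α ≤ stepBound n m l L) (K : ℕ) :
    ∑ k ∈ Finset.range K, ∫ ω,
        (‖gradient (globalFun f) (mean (randomState f W α x0 τ s k ω).x)‖ ^ 2
          + L ^ 2 * dispersion (randomState f W α x0 τ s k ω).x) ∂P
      ≤ 2 * (2 / α * (globalFun f x0 - globalInf f)
        + l ^ 2 * (1 - l ^ 2) * (1 / (n : ℝ) * ∑ i, ‖gradient (localFun f i) x0‖ ^ 2)) := by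
  have hl0 : 0 ≤ l := hl ▸ secondSingularValue_nonneg W
  have hl1 : l < 1 := hl ▸ hW.singular_lt_one
  have hd : 0 < 1 - l ^ 2 := by nlinarith
  have hsys := descentSystem hn hm hf hW hα x0 hs hl
  obtain ⟨h1, h2⟩ := hsys.sum_stationarity_le
    (stepCondition_of_le_stepBound hn hm hl0 hl1 hf.pos hα hαb) hα
    (by exact_mod_cast hn) (by exact_mod_cast hm) hl0 hl1 K
  have hF0 : ∫ ω, globalFun f (mean (randomState f W α x0 τ s 0 ω).x) ∂P = globalFun f x0 := by
    simp [randomState, run, initState, mean_const hn]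
  have hA0 : ∫ ω, dispersion (trackingInput f (randomState f W α x0 τ s 0 ω)) ∂P
      = dispersion (trackingInput f (initState n m x0)) := by
    simp [randomState, run]
  rw [hF0, hA0] at h1 h2
  have h3 := mul_le_mul_of_nonneg_left (dispersion_trackingInput_init_le (m := m) hn f x0)
    (by positivity : 0 ≤ l ^ 2 * (1 - l ^ 2))
  have h4 : ∑ k ∈ Finset.range K, ∫ ω, dispersion (randomState f W α x0 τ s k ω).x ∂P
      ≤ ∑ k ∈ Finset.range (K + 1), ∫ ω, dispersion (randomState f W α x0 τ s k ω).x ∂P := by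
    rw [Finset.sum_range_succ]
    linarith [hsys.X_nonneg K]
  have h5 := mul_le_mul_of_nonneg_left h4 (sq_nonneg L)
  have h6 : ∀ k, ∫ ω, (‖gradient (globalFun f) (mean (randomState f W α x0 τ s k ω).x)‖ ^ 2
          + L ^ 2 * dispersion (randomState f W α x0 τ s k ω).x) ∂P
      = ∫ ω, ‖gradient (globalFun f) (mean (randomState f W α x0 τ s k ω).x)‖ ^ 2 ∂P
        + L ^ 2 * ∫ ω, dispersion (randomState f W α x0 τ s k ω).x ∂P := by
    intro k
    rw [← integral_const_mul]
    exact integral_add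
      (integrable_randomState hm f W α x0 hs k fun S => ‖gradient (globalFun f) (mean S.x)‖ ^ 2)
      (integrable_randomState hm f W α x0 hs k fun S => L ^ 2 * dispersion S.x)
  simp only [h6, Finset.sum_add_distrib, ← Finset.mul_sum]
  linarith

lemma norm_sub_mean_sq_le (hn : 0 < n) (u : Fin n → Vec p) (i : Fin n) :
    ‖u i - mean u‖ ^ 2 ≤ n * dispersion u := by
  have hn' : (n : ℝ) ≠ 0 := by exact_mod_cast hn.ne'
  have h : n * dispersion u = ∑ i, ‖u i - mean u‖ ^ 2 := by
    unfold dispersion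
    field_simp
  rw [h]
  exact Finset.single_le_sum (f := fun i => ‖u i - mean u‖ ^ 2) (fun _ _ => sq_nonneg _)
    (Finset.mem_univ i)

lemma norm_sub_sq_le_dispersion (hn : 0 < n) (u : Fin n → Vec p) (i r : Fin n) :
    ‖u i - u r‖ ^ 2 ≤ 4 * n * dispersion u := by
  have h1 := norm_sub_mean_sq_le hn u i
  have h2 := norm_sub_mean_sq_le hn u r
  have h3 : ‖u i - u r‖ ≤ ‖u i - mean u‖ + ‖u r - mean u‖ := by
    have := norm_sub_le (u i - mean u) (u r - mean u)
    rwa [sub_sub_sub_cancel_right] at this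
  have h4 := pow_le_pow_left₀ (norm_nonneg _) h3 2
  nlinarith [sq_nonneg (‖u i - mean u‖ - ‖u r - mean u‖)]

lemma norm_gradient_globalFun_sq_le (hn : 0 < n) (hm : 0 < m) {f : Fin n → Fin m → Vec p → ℝ}
    {L : ℝ} (hf : SmoothBounded f L) (x y : Vec p) :
    ‖gradient (globalFun f) x‖ ^ 2
      ≤ 2 * (‖gradient (globalFun f) y‖ ^ 2 + L ^ 2 * ‖x - y‖ ^ 2) := by
  have h1 := norm_sq_le_of_norm_le (norm_gradient_globalFun_sub_le hn hm hf x y)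
  have h2 : ‖gradient (globalFun f) x‖ ≤ ‖gradient (globalFun f) x - gradient (globalFun f) y‖
      + ‖gradient (globalFun f) y‖ := by
    simpa using norm_add_le (gradient (globalFun f) x - gradient (globalFun f) y)
      (gradient (globalFun f) y)
  have h3 := pow_le_pow_left₀ (norm_nonneg _) h2 2
  nlinarith [sq_nonneg (‖gradient (globalFun f) x - gradient (globalFun f) y‖
    - ‖gradient (globalFun f) y‖)]

lemma average_norm_gradient_globalFun_sq_le (hn : 0 < n) (hm : 0 < m)
    {f : Fin n → Fin m → Vec p → ℝ} {L : ℝ} (hf : SmoothBounded f L) (u : Fin n → Vec p) :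
    1 / (n : ℝ) * ∑ i, ‖gradient (globalFun f) (u i)‖ ^ 2
      ≤ 2 * (‖gradient (globalFun f) (mean u)‖ ^ 2 + L ^ 2 * dispersion u) := by
  have hn' : (n : ℝ) ≠ 0 := by exact_mod_cast hn.ne'
  have h := mul_le_mul_of_nonneg_left
    (Finset.sum_le_sum fun i (_ : i ∈ (Finset.univ : Finset (Fin n))) =>
      norm_gradient_globalFun_sq_le hn hm hf (u i) (mean u)) (by positivity : 0 ≤ 1 / (n : ℝ))
  refine h.trans (le_of_eq ?_)
  simp only [← Finset.mul_sum, Finset.sum_add_distrib, Finset.sum_const, Finset.card_univ,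
    Fintype.card_fin, nsmul_eq_mul, dispersion]
  field_simp

/-- The factor 4 is 2 for passing from the nodes to their mean, times 2 for adding the stationarity
and consensus sums. -/
lemma stationarityGap_le (hn : 0 < n) (hm : 0 < m) {f : Fin n → Fin m → Vec p → ℝ} {L : ℝ}
    (hf : SmoothBounded f L) {W : Matrix (Fin n) (Fin n) ℝ} (hW : NetworkWeights W) {α : ℝ}
    (hα : 0 < α) (x0 : Vec p) {τ s : ℕ → Fin n → Ω → Fin m} (hs : IndependentSampling P τ s)
    {l : ℝ} (hl : l = secondSingularValue W) (hαb : α ≤ stepBound n m l L) (K : ℕ) :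
    stationarityGap P f W α x0 τ s K
      ≤ 4 / K * (2 / α * (globalFun f x0 - globalInf f)
        + l ^ 2 * (1 - l ^ 2) * (1 / (n : ℝ) * ∑ i, ‖gradient (localFun f i) x0‖ ^ 2)) := by
  have hI : ∀ k (g : State n m p → ℝ), Integrable (fun ω => g (randomState f W α x0 τ s k ω)) P :=
    integrable_randomState hm f W α x0 hs
  have h1 : ∀ k, 1 / (n : ℝ) * ∑ i, ∫ ω, ‖gradient (globalFun f)
        (iterate f W α x0 τ s k i ω)‖ ^ 2 ∂P
      ≤ 2 * ∫ ω, (‖gradient (globalFun f) (mean (randomState f W α x0 τ s k ω).x)‖ ^ 2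
          + L ^ 2 * dispersion (randomState f W α x0 τ s k ω).x) ∂P := by
    intro k
    change 1 / (n : ℝ) * ∑ i, ∫ ω, ‖gradient (globalFun f)
      ((randomState f W α x0 τ s k ω).x i)‖ ^ 2 ∂P ≤ _
    rw [← integral_finsetSum _ fun i _ => hI k fun S => ‖gradient (globalFun f) (S.x i)‖ ^ 2,
      ← integral_const_mul, ← integral_const_mul]
    exact integral_mono
      (hI k fun S => 1 / (n : ℝ) * ∑ i, ‖gradient (globalFun f) (S.x i)‖ ^ 2)
      (hI k fun S => 2 * (‖gradient (globalFun f) (mean S.x)‖ ^ 2 + L ^ 2 * dispersion S.x))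
      fun ω => average_norm_gradient_globalFun_sq_le hn hm hf _
  have h2 : stationarityGap P f W α x0 τ s K = 1 / (K : ℝ) * ∑ k ∈ Finset.range K,
      1 / (n : ℝ) * ∑ i, ∫ ω, ‖gradient (globalFun f) (iterate f W α x0 τ s k i ω)‖ ^ 2 ∂P := by
    rw [stationarityGap, ← Finset.mul_sum, ← Finset.mul_sum, Finset.sum_comm]
    ring
  have h3 := Finset.sum_le_sum fun k (_ : k ∈ Finset.range K) => h1 k
  rw [← Finset.mul_sum (s := Finset.range K) (a := (2 : ℝ))] at h3
  have h4 := sum_integral_le hn hm hf hW hα x0 hs hl hαb K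
  have h5 := mul_le_mul_of_nonneg_left (h3.trans (mul_le_mul_of_nonneg_left h4 zero_le_two))
    (by positivity : 0 ≤ 1 / (K : ℝ))
  rw [h2]
  refine h5.trans (le_of_eq ?_)
  ring

end Expectations

/-! ### Limits and iteration complexity. -/

section Conclusions

variable {n m p : ℕ} {Ω : Type*} [MeasurableSpace Ω] {P : Measure Ω} [IsProbabilityMeasure P]

/-- The single summable quantity `Z` dominates both squared norms, up to factors depending only on n
and L. -/
lemma consensus_and_stationarity (hn : 0 < n) (hm : 0 < m) {f : Fin n → Fin m → Vec p → ℝ} {L : ℝ}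
    (hf : SmoothBounded f L) {W : Matrix (Fin n) (Fin n) ℝ} (hW : NetworkWeights W) {α : ℝ}
    (hα : 0 < α) (x0 : Vec p) {τ s : ℕ → Fin n → Ω → Fin m} (hs : IndependentSampling P τ s)
    {l : ℝ} (hl : l = secondSingularValue W) (hαb : α ≤ stepBound n m l L) (i r : Fin n) :
    ((∀ᵐ ω ∂P, Tendsto (fun k => ‖iterate f W α x0 τ s k i ω - iterate f W α x0 τ s k r ω‖)
        atTop (𝓝 0)) ∧
      Tendsto (fun k => ∫ ω, ‖iterate f W α x0 τ s k i ω - iterate f W α x0 τ s k r ω‖ ^ 2 ∂P)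
        atTop (𝓝 0)) ∧
    ((∀ᵐ ω ∂P, Tendsto (fun k => ‖gradient (globalFun f) (iterate f W α x0 τ s k i ω)‖)
        atTop (𝓝 0)) ∧
      Tendsto (fun k => ∫ ω, ‖gradient (globalFun f) (iterate f W α x0 τ s k i ω)‖ ^ 2 ∂P)
        atTop (𝓝 0)) := by
  have hL := hf.pos
  have hn' : (1 : ℝ) ≤ n := by exact_mod_cast hn
  have hI : ∀ k (g : State n m p → ℝ), Integrable (fun ω => g (randomState f W α x0 τ s k ω)) P :=
    integrable_randomState hm f W α x0 hs
  set Z : ℕ → Ω → ℝ := fun k ω =>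
    ‖gradient (globalFun f) (mean (randomState f W α x0 τ s k ω).x)‖ ^ 2
      + L ^ 2 * dispersion (randomState f W α x0 τ s k ω).x with hZ
  have hX : ∀ k ω, 0 ≤ dispersion (randomState f W α x0 τ s k ω).x :=
    fun k ω => dispersion_nonneg _
  have hZ0 : ∀ k ω, 0 ≤ Z k ω := fun k ω =>
    add_nonneg (sq_nonneg _) (mul_nonneg (sq_nonneg _) (hX k ω))
  have hZi : ∀ k, Integrable (Z k) P := fun k =>
    hI k fun S => ‖gradient (globalFun f) (mean S.x)‖ ^ 2 + L ^ 2 * dispersion S.x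
  have hB := sum_integral_le hn hm hf hW hα x0 hs hl hαb
  constructor
  · refine tendsto_zero_of_sq_le (Z := Z) (c := 4 * n / L ^ 2) (fun k ω => norm_nonneg _)
      (fun k => hI k fun S => ‖S.x i - S.x r‖ ^ 2) hZ0 hZi hB fun k ω => ?_
    refine (norm_sub_sq_le_dispersion hn (randomState f W α x0 τ s k ω).x i r).trans ?_
    have h1 : 4 * n * dispersion (randomState f W α x0 τ s k ω).x
        = 4 * n / L ^ 2 * (L ^ 2 * dispersion (randomState f W α x0 τ s k ω).x) := by
      field_simp
    rw [h1]
    gcongr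
    exact le_add_of_nonneg_left (sq_nonneg _)
  · refine tendsto_zero_of_sq_le (Z := Z) (c := 2 * n) (fun k ω => norm_nonneg _)
      (fun k => hI k fun S => ‖gradient (globalFun f) (S.x i)‖ ^ 2) hZ0 hZi hB fun k ω => ?_
    set S := randomState f W α x0 τ s k ω with hS
    have h1 := norm_gradient_globalFun_sq_le hn hm hf (S.x i) (mean S.x)
    have h2 := mul_le_mul_of_nonneg_left (norm_sub_mean_sq_le hn S.x i) (sq_nonneg L)
    have h3 : ‖gradient (globalFun f) (mean S.x)‖ ^ 2
        ≤ n * ‖gradient (globalFun f) (mean S.x)‖ ^ 2 :=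
      le_mul_of_one_le_left (sq_nonneg _) hn'
    refine h1.trans ?_
    change _ ≤ 2 * n * (‖gradient (globalFun f) (mean S.x)‖ ^ 2 + L ^ 2 * dispersion S.x)
    linarith

lemma iterationComplexity_le (hn : 0 < n) (hm : 0 < m) {f : Fin n → Fin m → Vec p → ℝ} {L : ℝ}
    (hf : SmoothBounded f L) {W : Matrix (Fin n) (Fin n) ℝ} (hW : NetworkWeights W)
    (x0 : Vec p) {τ s : ℕ → Fin n → Ω → Fin m} (hs : IndependentSampling P τ s)
    {l : ℝ} (hl : l = secondSingularValue W) {ε : ℝ} (hε : 0 < ε) :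
    iterationComplexity P f W (stepBound n m l L) x0 τ s ε
      ≤ ((max 1 ⌈384 * (complexityFactor n m l * L * (globalFun f x0 - globalInf f) / ε
          + l ^ 2 * (1 - l ^ 2) * (∑ i, ‖gradient (localFun f i) x0‖ ^ 2) / (n * ε))⌉₊ : ℕ)
            : ℕ∞) := by
  have hL := hf.pos
  have hn' : (0 : ℝ) < n := by exact_mod_cast hn
  have hl0 : 0 ≤ l := hl ▸ secondSingularValue_nonneg W
  have hl1 : l < 1 := hl ▸ hW.singular_lt_one
  have hd : 0 < 1 - l ^ 2 := by nlinarith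
  have hE := one_le_complexityFactor n m l
  have hlow := one_div_le_stepBound hn hm hl0 hl1 hL
  set E := complexityFactor n m l
  set α := stepBound n m l L with hα
  have hE0 : 0 < E := by linarith
  have hα0 : 0 < α := lt_of_lt_of_le (by positivity) hlow
  have hαinv : 1 / α ≤ 48 * E * L := by
    rw [div_le_comm₀ hα0 (by positivity)]
    exact hlow
  have hΔ : 0 ≤ globalFun f x0 - globalInf f := sub_nonneg.mpr (globalInf_le hf x0)
  set Δ := globalFun f x0 - globalInf f
  set D := ∑ i, ‖gradient (localFun f i) x0‖ ^ 2 with hD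
  have hD0 : 0 ≤ D := Finset.sum_nonneg fun _ _ => sq_nonneg _
  -- 384 = 4 · 2 · 48: the factors 4 and 2/α of `stationarityGap_le`, with 1/α ≤ 48 E L. The initial
  -- gradient term would need only 4.
  set R := 384 * (E * L * Δ / ε + l ^ 2 * (1 - l ^ 2) * D / (n * ε)) with hR
  have hK1 : 1 ≤ max 1 ⌈R⌉₊ := le_max_left _ _
  have hKR : R ≤ ((max 1 ⌈R⌉₊ : ℕ) : ℝ) :=
    (Nat.le_ceil R).trans (by exact_mod_cast le_max_right _ _)
  set K := max 1 ⌈R⌉₊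
  have hK0 : (0 : ℝ) < K := by exact_mod_cast hK1
  refine iInf_le (fun K : {K : ℕ // 1 ≤ K ∧ stationarityGap P f W α x0 τ s K ≤ ε} =>
    ((K : ℕ) : ℕ∞)) ⟨K, hK1, ?_⟩
  refine (stationarityGap_le hn hm hf hW hα0 x0 hs hl le_rfl K).trans ?_
  rw [div_mul_eq_mul_div, div_le_iff₀ hK0]
  have h1 : R * ε = 384 * (E * L * Δ + l ^ 2 * (1 - l ^ 2) * (1 / n * D)) := by
    rw [hR]
    field_simp
  have h2 := mul_le_mul_of_nonneg_right hKR hε.le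
  have h3 := mul_le_mul_of_nonneg_right hαinv hΔ
  have h4 : 0 ≤ l ^ 2 * (1 - l ^ 2) * (1 / n * D) := by positivity
  have h5 : 2 / α * Δ = 2 * (1 / α * Δ) := by ring
  rw [h5]
  linarith

end Conclusions

end GTSAGA

theorem theorem1 :
    ∃ C : ℝ, 0 < C ∧
      ∀ (n m p : ℕ) (_hn : 0 < n) (_hm : 0 < m)
        (f : Fin n → Fin m → GTSAGA.Vec p → ℝ) (L : ℝ) (_hf : GTSAGA.SmoothBounded f L)
        (W : Matrix (Fin n) (Fin n) ℝ) (_hW : GTSAGA.NetworkWeights W)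
        (x0 : GTSAGA.Vec p)
        (Ω : Type*) [MeasurableSpace Ω] (P : Measure Ω) [IsProbabilityMeasure P]
        (τ s : ℕ → Fin n → Ω → Fin m) (_hs : GTSAGA.IndependentSampling P τ s)
        (lam : ℝ) (_hlam : lam = GTSAGA.secondSingularValue W),
        -- consensus and stationarity for every admissible step-size
        (∀ α : ℝ, 0 < α → α ≤ GTSAGA.stepBound n m lam L →
          ∀ i r : Fin n,
            (∀ᵐ ω ∂P, Tendsto (fun k => ‖GTSAGA.iterate f W α x0 τ s k i ω
                - GTSAGA.iterate f W α x0 τ s k r ω‖) atTop (𝓝 0)) ∧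
            ((∀ k, Integrable (fun ω => ‖GTSAGA.iterate f W α x0 τ s k i ω
                - GTSAGA.iterate f W α x0 τ s k r ω‖ ^ 2) P) ∧
              Tendsto (fun k => ∫ ω, ‖GTSAGA.iterate f W α x0 τ s k i ω
                - GTSAGA.iterate f W α x0 τ s k r ω‖ ^ 2 ∂P) atTop (𝓝 0)) ∧
            (∀ᵐ ω ∂P, Tendsto (fun k => ‖gradient (GTSAGA.globalFun f)
                (GTSAGA.iterate f W α x0 τ s k i ω)‖) atTop (𝓝 0)) ∧
            ((∀ k, Integrable (fun ω => ‖gradient (GTSAGA.globalFun f)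
                (GTSAGA.iterate f W α x0 τ s k i ω)‖ ^ 2) P) ∧
              Tendsto (fun k => ∫ ω, ‖gradient (GTSAGA.globalFun f)
                (GTSAGA.iterate f W α x0 τ s k i ω)‖ ^ 2 ∂P) atTop (𝓝 0))) ∧
        -- iteration complexity for the largest admissible step-size
        (∀ ε : ℝ, 0 < ε →
          GTSAGA.iterationComplexity P f W (GTSAGA.stepBound n m lam L) x0 τ s ε ≤
            ((max 1 ⌈C * (GTSAGA.complexityFactor n m lam * L
                  * (GTSAGA.globalFun f x0 - GTSAGA.globalInf f) / ε
                + lam ^ 2 * (1 - lam ^ 2)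
                  * (∑ i, ‖gradient (GTSAGA.localFun f i) x0‖ ^ 2) / (n * ε))⌉₊ : ℕ) : ℕ∞)) := by
  refine ⟨384, by norm_num, ?_⟩
  intro n m p hn hm f L hf W hW x0 Ω _ P _ τ s hs lam hlam
  refine ⟨fun α hα hαb i r => ?_, fun ε hε =>
    GTSAGA.iterationComplexity_le hn hm hf hW x0 hs hlam hε⟩
  have hI : ∀ k (g : GTSAGA.State n m p → ℝ),
      Integrable (fun ω => g (GTSAGA.randomState f W α x0 τ s k ω)) P :=
    GTSAGA.integrable_randomState hm f W α x0 hs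
  obtain ⟨⟨h1, h2⟩, h3, h4⟩ :=
    GTSAGA.consensus_and_stationarity hn hm hf hW hα x0 hs hlam hαb i r
  exact ⟨h1, ⟨fun k => hI k fun S => ‖S.x i - S.x r‖ ^ 2, h2⟩, h3,
    fun k => hI k fun S => ‖gradient (GTSAGA.globalFun f) (S.x i)‖ ^ 2, h4⟩
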